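/- **Setting.** An instance of the multi-vehicle non-preemptive dial-a-ride problem consists of a finite set $V$ of locations with a function $w:V\times V\to\mathbb R$ satisfying $w(a,a)=0$, $w(a,b)=w(b,a)$ and $w(a,c)\le w(a,b)+w(b,c)$ (distinct locations may have distance $0$), $m$ requests $(s_j,t_j)\in V\times V$, $h\ge 1$ vehicles with initial locations $o_1,\dots,o_h\in V$, and a common capacity $\lambda\ge 1$. A solution assigns to each vehicle $i$ a walk that starts at $o_i$ and need not return. Along the walks every request $j$ is picked up (at $s_j$) exactly once and is afterwards delivered (at $t_j$) exactly once, by the same vehicle, and no vehicle ever carries more than $\lambda$ items. $\mathrm{OPT}$ is the infimum of the total weight of the walks over all solutions. **Alg.1.** (1) Let $H$ be the complete graph with vertices $k_1,\dots,k_h$ (depots) and $l_1,\dots,l_m$ and weights $\widetilde w(k_i,k_j)=2w(o_i,o_j)$, $\widetilde w(k_i,l_j)=w(o_i,s_j)+w(o_i,t_j)$, $\widetilde w(l_i,l_j)=w(s_i,s_j)+w(t_i,t_j)$. Compute a family $\mathcal T$ of closed tours in $H$ such that every vertex lies on exactly one tour and every tour contains exactly one depot, with total weight at most twice the minimum. (2)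 For each depot $k_i$, let $k_i\,l_{j_1}\cdots l_{j_r}$ be its tour. If $r\le\lambda$, vehicle $i$ picks up $j_1,\dots,j_r$ and then delivers $j_1,\dots,j_r$, in this order. If $r>\lambda$, draw $\theta_i$ uniformly from $\{1,\dots,\lambda\}$ (independently for different $i$) and cut $j_1,\dots,j_r$ into the fragment of the first $\theta_i$ requests, followed by fragments of $\lambda$ requests each, the last one possibly shorter; vehicle $i$ serves the fragments one after the other, each by picking up all its requests and then delivering all of them, both in the order of the fragment. **Theorem.** For the multi-vehicle non-preemptive dial-a-ride problem, Alg.1 is an $O(\sqrt\lambda\,\log m)$-approximation algorithm with running time $O(m^2)$. Precisely: 1. There is an absolute constant $C$ such that for every instance, and for every 2-approximate family $\mathcal T$ used in step (1), the routes formed in step (2) are a feasible solution for every choice of the offsets $\theta_i\in\{1,\dots,\lambda\}$, and their expected total weight over the random offsets is at most $C\,\sqrt{\lambda}\,\log(m+1)\cdot\mathrm{OPT}$. 2. There is one program for a random access machine (cells with natural numbers and with real numbers; unit-cost addition, subtraction, comparison, indirect addressing, lookup of $w$, and drawing of independent uniform elements of $\{1,\dots,\lambda\}$) that carries out Alg.1.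 On every instance with $m\geq 1$ and $h=O(m)$ there is a 2-approximate family $\mathcal T$, not depending on the random draws, such that, for all outcomes of the draws, the program halts after $O(m^2)$ steps and its output is the set of routes that step (2) forms from $\mathcal T$ and the drawn offsets. Here, for every $\kappa$, the constant in $O(m^2)$ can be chosen uniformly for all instances with $h\le\kappa m$. -/

import Mathlib

open scoped BigOperators

namespace MDaRP

/-! ### Walks and tours -/

/-- The weight of the walk `v₁ v₂ … v_r`, that is `d v₁ v₂ + d v₂ v₃ + … + d v_{r-1} v_r`. -/
def walkWeight {α : Type*} (d : α → α → ℝ) : List α → ℝ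
  | x :: y :: l => d x y + walkWeight d (y :: l)
  | _ => 0

/-- The weight of the tour `v₁ v₂ … v_r`: the walk together with the closing edge `v_r v₁`. -/
def tourWeight {α : Type*} (d : α → α → ℝ) : List α → ℝ
  | [] => 0
  | x :: l => walkWeight d (x :: (l ++ [x]))

/-! ### The multi-vehicle non-preemptive dial-a-ride problem -/

/-- An instance: a finite metric `w` on `n` locations (distinct locations may have distance zero),
`m` requests with sources `src j` and destinations `dst j`, and `h ≥ 1` vehicles of common capacity
`cap ≥ 1` with initial locations `depot i`. -/
structure Instance where
  n : ℕ
  h : ℕ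
  m : ℕ
  cap : ℕ
  w : Fin n → Fin n → ℝ
  src : Fin m → Fin n
  dst : Fin m → Fin n
  depot : Fin h → Fin n
  w_self : ∀ a, w a a = 0
  w_symm : ∀ a b, w a b = w b a
  w_triangle : ∀ a b c, w a c ≤ w a b + w b c
  h_pos : 0 < h
  cap_pos : 0 < cap

/-- One entry of a route: passing through a location, picking up the item of a request at its
source, or delivering the item of a request at its destination. -/
inductive Stop (n m : ℕ) where
  | visit (v : Fin n)
  | pickup (j : Fin m)
  | deliver (j : Fin m)
  deriving DecidableEq

def Stop.isPickup {n m : ℕ} : Stop n m → Bool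
  | .pickup _ => true
  | _ => false

def Stop.isDelivery {n m : ℕ} : Stop n m → Bool
  | .deliver _ => true
  | _ => false

namespace Instance

variable (I : Instance)

/-- The location at which a stop takes place. -/
def loc : Stop I.n I.m → Fin I.n
  | .visit v => v
  | .pickup j => I.src j
  | .deliver j => I.dst j

/-- A family of routes, one (possibly empty) route per vehicle. -/
abbrev Routes : Type := Fin I.h → List (Stop I.n I.m)

/-- The total weight of the routes. Vehicle `i` starts at `depot i` and need not return. -/
noncomputable def weight (R : I.Routes) : ℝ :=
  ∑ i, walkWeight I.w (I.depot i :: (R i).map I.loc)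

/-- Feasible non-preemptive solutions. -/
structure IsFeasible (R : I.Routes) : Prop where
  /-- every item is picked up exactly once, by exactly one vehicle -/
  pickup_once : ∀ j, ∑ i, (R i).count (.pickup j) = 1
  /-- it is delivered exactly once, by the vehicle that picked it up -/
  same_vehicle : ∀ i j, (R i).count (.deliver j) = (R i).count (.pickup j)
  /-- it is delivered only after it was picked up -/
  order : ∀ i j p, p <+: R i → p.count (.deliver j) ≤ p.count (.pickup j)
  /-- at every moment at most `cap` items are on board -/
  capacity : ∀ i p, p <+: R i → p.countP Stop.isPickup ≤ p.countP Stop.isDelivery + I.cap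

/-- The weight of an optimal solution. -/
noncomputable def opt : ℝ := sInf {x | ∃ R : I.Routes, I.IsFeasible R ∧ I.weight R = x}

/-! ### The graph `H` and the multi-depot TSP in it -/

/-- The weight function of the complete graph `H`, which has one vertex `Sum.inl i` for every vehicle
(these are the depots) and one vertex `Sum.inr j` for every request. -/
def wH : Fin I.h ⊕ Fin I.m → Fin I.h ⊕ Fin I.m → ℝ
  | .inl i, .inl i' => 2 * I.w (I.depot i) (I.depot i')
  | .inl i, .inr j => I.w (I.depot i) (I.src j) + I.w (I.depot i) (I.dst j)
  | .inr j, .inl i => I.w (I.depot i) (I.src j) + I.w (I.depot i) (I.dst j)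
  | .inr j, .inr j' => I.w (I.src j) (I.src j') + I.w (I.dst j) (I.dst j')

/-- A family of tours in `H`, one for every depot. `T i` lists the request vertices of the tour
through depot `i`, in the order of the tour, which is read off starting from the depot. -/
abbrev Tours : Type := Fin I.h → List (Fin I.m)

/-- `T` is a solution of the multi-depot TSP in `H`: every request vertex lies in exactly one of the
tours, and there exactly once. (Every tour contains exactly one depot by construction.) -/
def IsMTSP (T : I.Tours) : Prop := ∀ j, ∑ i, (T i).count j = 1

/-- The weight of a family of tours in `H`. -/
noncomputable def mtspWeight (T : I.Tours) : ℝ :=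
  ∑ i, tourWeight I.wH (Sum.inl i :: (T i).map Sum.inr)

/-- `T` is a 2-approximate solution of the multi-depot TSP in `H`. -/
def IsTwoApproxMTSP (T : I.Tours) : Prop :=
  I.IsMTSP T ∧ ∀ S : I.Tours, I.IsMTSP S → I.mtspWeight T ≤ 2 * I.mtspWeight S

/-! ### The algorithm -/

/-- Cutting the request sequence `L` of a tour: the first fragment has the first `θ` requests, the
next ones have `c` requests each, and the last one has the remaining ones. There are
`⌈(L.length - θ) / c⌉ + 1` fragments. -/
def fragments (c θ : ℕ) {α : Type*} (L : List α) : List (List α) :=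
  L.take θ :: (List.range ((L.length - θ) ⌈/⌉ c)).map fun k => (L.drop (θ + c * k)).take c

/-- Serve the requests of a fragment: visit all its sources, then all its destinations, both in the
order of the fragment. -/
def serve (B : List (Fin I.m)) : List (Stop I.n I.m) :=
  B.map Stop.pickup ++ B.map Stop.deliver

/-- The routes that the algorithm forms from the tours `T` in `H` and the offsets `θ`. A tour with at
most `cap` requests is not cut. -/
def algRoutes (T : I.Tours) (θ : Fin I.h → ℕ) : I.Routes := fun i =>
  if (T i).length ≤ I.cap then I.serve (T i)
  else (fragments I.cap (θ i) (T i)).flatMap I.serve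

/-- The expected weight of the routes when the offsets are independent and uniform in
`{1, …, cap}`. -/
noncomputable def algExpectedWeight (T : I.Tours) : ℝ :=
  𝔼 θ : Fin I.h → Fin I.cap, I.weight (I.algRoutes T fun i => (θ i : ℕ) + 1)

end Instance

/-! ### A random access machine over the reals, with unit costs

The memory consists of arrays of natural numbers and arrays of real numbers. A program names finitely
many of them; cells are addressed by computed indices. Natural numbers can only be added, subtracted
(truncated at zero) and compared, real numbers can only be added, subtracted and compared. The
distance table of the instance is read-only. Every operation costs one step. -/

inductive NExp where
  | const (k : ℕ)
  | read (a : ℕ) (i : NExp)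
  | add (e f : NExp)
  | sub (e f : NExp)

inductive RExp where
  | read (a : ℕ) (i : NExp)
  | dist (u v : NExp)
  | add (e f : RExp)
  | sub (e f : RExp)

inductive Test where
  | ltN (e f : NExp)
  | ltR (e f : RExp)
  | neg (b : Test)
  | conj (b c : Test)

inductive Cmd where
  | skip
  /-- `natArray a [i] := e` -/
  | setN (a : ℕ) (i e : NExp)
  /-- `realArray a [i] := e` -/
  | setR (a : ℕ) (i : NExp) (e : RExp)
  /-- `natArray a [i] :=` the next number on the random tape -/
  | draw (a : ℕ) (i : NExp)
  | seq (p q : Cmd)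
  | ite (b : Test) (p q : Cmd)
  | loop (b : Test) (p : Cmd)

structure State where
  nat : ℕ → ℕ → ℕ
  real : ℕ → ℕ → ℝ
  tape : ℕ → ℕ

namespace State

def writeN (s : State) (a i x : ℕ) : State :=
  { s with nat := Function.update s.nat a (Function.update (s.nat a) i x) }

noncomputable def writeR (s : State) (a i : ℕ) (x : ℝ) : State :=
  { s with real := Function.update s.real a (Function.update (s.real a) i x) }

def popTape (s : State) : State := { s with tape := fun k => s.tape (k + 1) }

end State

namespace NExp

def eval (s : State) : NExp → ℕ
  | const k => k
  | read a i => s.nat a (i.eval s)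
  | add e f => e.eval s + f.eval s
  | sub e f => e.eval s - f.eval s

def cost : NExp → ℕ
  | const _ => 1
  | read _ i => i.cost + 1
  | add e f => e.cost + f.cost + 1
  | sub e f => e.cost + f.cost + 1

end NExp

namespace RExp

/-- `D` is the distance table. -/
noncomputable def eval (D : ℕ → ℕ → ℝ) (s : State) : RExp → ℝ
  | read a i => s.real a (i.eval s)
  | dist u v => D (u.eval s) (v.eval s)
  | add e f => e.eval D s + f.eval D s
  | sub e f => e.eval D s - f.eval D s

def cost : RExp → ℕ
  | read _ i => i.cost + 1
  | dist u v => u.cost + v.cost + 1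
  | add e f => e.cost + f.cost + 1
  | sub e f => e.cost + f.cost + 1

end RExp

namespace Test

def Holds (D : ℕ → ℕ → ℝ) (s : State) : Test → Prop
  | ltN e f => e.eval s < f.eval s
  | ltR e f => e.eval D s < f.eval D s
  | neg b => ¬ b.Holds D s
  | conj b c => b.Holds D s ∧ c.Holds D s

def cost : Test → ℕ
  | ltN e f => e.cost + f.cost + 1
  | ltR e f => e.cost + f.cost + 1
  | neg b => b.cost + 1
  | conj b c => b.cost + c.cost + 1

end Test

/-- `Exec D p s s' t`: the program `p`, started in the state `s`, halts in the state `s'` after `t`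
steps. -/
inductive Exec (D : ℕ → ℕ → ℝ) : Cmd → State → State → ℕ → Prop where
  | skip (s : State) : Exec D .skip s s 1
  | setN (s : State) (a : ℕ) (i e : NExp) :
      Exec D (.setN a i e) s (s.writeN a (i.eval s) (e.eval s)) (i.cost + e.cost + 1)
  | setR (s : State) (a : ℕ) (i : NExp) (e : RExp) :
      Exec D (.setR a i e) s (s.writeR a (i.eval s) (e.eval D s)) (i.cost + e.cost + 1)
  | draw (s : State) (a : ℕ) (i : NExp) :
      Exec D (.draw a i) s ((s.writeN a (i.eval s) (s.tape 0)).popTape) (i.cost + 1)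
  | seq {p q : Cmd} {s₁ s₂ s₃ : State} {t u : ℕ} (hp : Exec D p s₁ s₂ t) (hq : Exec D q s₂ s₃ u) :
      Exec D (.seq p q) s₁ s₃ (t + u)
  | ite_true {b : Test} {p q : Cmd} {s s' : State} {t : ℕ} (hb : b.Holds D s)
      (hp : Exec D p s s' t) : Exec D (.ite b p q) s s' (b.cost + t + 1)
  | ite_false {b : Test} {p q : Cmd} {s s' : State} {t : ℕ} (hb : ¬ b.Holds D s)
      (hq : Exec D q s s' t) : Exec D (.ite b p q) s s' (b.cost + t + 1)
  | loop_done {b : Test} {p : Cmd} {s : State} (hb : ¬ b.Holds D s) :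
      Exec D (.loop b p) s s (b.cost + 1)
  | loop_step {b : Test} {p : Cmd} {s₁ s₂ s₃ : State} {t u : ℕ} (hb : b.Holds D s₁)
      (hp : Exec D p s₁ s₂ t) (hl : Exec D (.loop b p) s₂ s₃ u) :
      Exec D (.loop b p) s₁ s₃ (b.cost + t + u + 1)

/-- Executions are deterministic, given the random tape. -/
theorem Exec.det {D : ℕ → ℕ → ℝ} {p : Cmd} {s s₁ s₂ : State} {t₁ t₂ : ℕ}
    (e₁ : Exec D p s s₁ t₁) (e₂ : Exec D p s s₂ t₂) : s₁ = s₂ ∧ t₁ = t₂ := by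
  induction e₁ generalizing s₂ t₂ with
  | skip | setN | setR | draw => cases e₂; exact ⟨rfl, rfl⟩
  | seq _ _ ihp ihq =>
    cases e₂ with
    | seq hp hq =>
      obtain ⟨rfl, rfl⟩ := ihp hp
      obtain ⟨rfl, rfl⟩ := ihq hq
      exact ⟨rfl, rfl⟩
  | ite_true hb _ ih =>
    cases e₂ with
    | ite_true _ hp => obtain ⟨rfl, rfl⟩ := ih hp; exact ⟨rfl, rfl⟩
    | ite_false hn _ => exact absurd hb hn
  | ite_false hb _ ih =>
    cases e₂ with
    | ite_true hn _ => exact absurd hn hb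
    | ite_false _ hp => obtain ⟨rfl, rfl⟩ := ih hp; exact ⟨rfl, rfl⟩
  | loop_done hb =>
    cases e₂ with
    | loop_done => exact ⟨rfl, rfl⟩
    | loop_step hn => exact absurd hn hb
  | loop_step hb _ _ ihp ihl =>
    cases e₂ with
    | loop_done hn => exact absurd hb hn
    | loop_step _ hp hl =>
      obtain ⟨rfl, rfl⟩ := ihp hp
      obtain ⟨rfl, rfl⟩ := ihl hl
      exact ⟨rfl, rfl⟩

/-! ### Input and output of the machine -/

namespace Instance

variable (I : Instance)

/-- The distance table. -/
noncomputable def table (u v : ℕ) : ℝ :=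
  if hu : u < I.n then if hv : v < I.n then I.w ⟨u, hu⟩ ⟨v, hv⟩ else 0 else 0

/-- The initial state with random tape `ω`: array `0` holds `n, h, m, cap`, the arrays `1`, `2`, `3`
hold the sources, the destinations and the initial locations, all other cells are zero. -/
def initState (ω : ℕ → ℕ) : State where
  nat a k :=
    match a with
    | 0 => ([I.n, I.h, I.m, I.cap][k]?).getD 0
    | 1 => if hk : k < I.m then (I.src ⟨k, hk⟩ : ℕ) else 0
    | 2 => if hk : k < I.m then (I.dst ⟨k, hk⟩ : ℕ) else 0
    | 3 => if hk : k < I.h then (I.depot ⟨k, hk⟩ : ℕ) else 0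
    | _ => 0
  real _ _ := 0
  tape := ω

/-- The code of a stop, a positive number. -/
def code : Stop I.n I.m → ℕ
  | .visit v => 3 * v + 1
  | .pickup j => 3 * j + 2
  | .deliver j => 3 * j + 3

/-- Routes as a word: the codes of the stops of the vehicles' routes, one vehicle after the other,
every route being followed by the end marker `0`. -/
def encode (R : I.Routes) : List ℕ :=
  (List.finRange I.h).flatMap fun i => (R i).map I.code ++ [0]

/-- The state `s` holds the routes `R` as its output: the length of their encoding is the first entry
of array `4`, the encoding itself is at the beginning of array `5`. -/
def IsOutput (s : State) (R : I.Routes) : Prop :=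
  s.nat 4 0 = (I.encode R).length ∧
    ∀ k (hk : k < (I.encode R).length), s.nat 5 k = (I.encode R)[k]

end Instance

end MDaRP

/-! Approximation. Let `R` be any feasible solution and `W` its weight. Two lower bounds on `W` are
needed. (a) A vehicle carries at most `cap` items, so each step of its route is charged by at most
`cap` requests when `w (src j) (dst j)` is spread over the part of the route between pickup and
delivery. Hence the hauls sum to at most `cap * W` (`sum_w_le`). (b) The graph `H` has a multi-depot
TSP solution of weight O(√cap · log m) · `W` (`exists_isMTSP`). Measure positions along one route by
the distance travelled. A request becomes an interval from its pickup to its delivery, or a point of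
the plane with these two positions as coordinates, and the distance in `H` of two requests is at
most the ℓ₁-distance of their points. Cut at a median of the starting points: at most `cap`
intervals contain the cut, and their points lie in a square whose side is the length of the range,
so the strip method visits them on a path of O(√cap) sides. The intervals on either side of the cut
are ordered recursively; the ranges of one level add up to at most the route, and there are O(log m)
levels (`exists_order_of_depth_le`).

Conversely, serving a fragment follows the tour twice, except for two detours between source and
destination of its last request (`walkWeight_flatMap_serve_le`). The last request of the whole tour
is paid for by the closing edge at the depot. Any other request ends a fragment only if its position
is congruent to the offset modulo `cap`, which has probability 1/`cap`. So the expected weight is at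
most twice the tours plus 2/`cap` times the sum of the hauls (`algExpectedWeight_le`), and (a) and
(b) finish the argument.

Program. Prim's algorithm, with all depots as roots, grows a minimum spanning forest of `H` in which
every tree has one depot. Inserting each new request behind its nearest forest vertex in a linked
list costs at most twice the new edge, as in doubling a tree and shortcutting. That the forest is no
heavier than any solution `S` is shown by an exchange: the tours of `S`, opened to paths, connect
all requests to the depots, and each Prim step deletes from these paths an edge at least as long as
the one it adds (`exists_completion_insert`). One step takes O(m) time; tracing the lists writes the
routes. -/

namespace MDaRP

/-! ### Weights of walks -/

section Walk

variable {α β : Type*} (d : α → α → ℝ)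

@[simp] theorem walkWeight_nil : walkWeight d [] = 0 := rfl

@[simp] theorem walkWeight_singleton (x : α) : walkWeight d [x] = 0 := rfl

@[simp] theorem walkWeight_cons_cons (x y : α) (l : List α) :
    walkWeight d (x :: y :: l) = d x y + walkWeight d (y :: l) := rfl

theorem walkWeight_append_cons (l₁ : List α) (x : α) (l₂ : List α) :
    walkWeight d (l₁ ++ x :: l₂) = walkWeight d (l₁ ++ [x]) + walkWeight d (x :: l₂) := by
  induction l₁ with
  | nil => simp
  | cons a l ih =>
    cases l with
    | nil => simp
    | cons b l => simp only [List.cons_append, walkWeight_cons_cons] at ih ⊢; rw [ih]; ring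

theorem walkWeight_append_cons_cons (l₁ : List α) (x y : α) (l₂ : List α) :
    walkWeight d (l₁ ++ x :: y :: l₂) =
      walkWeight d (l₁ ++ [x]) + d x y + walkWeight d (y :: l₂) := by
  rw [walkWeight_append_cons, walkWeight_cons_cons]; ring

theorem walkWeight_map (f : β → α) (l : List β) :
    walkWeight d (l.map f) = walkWeight (fun a b => d (f a) (f b)) l := by
  induction l with
  | nil => rfl
  | cons a l ih =>
    cases l with
    | nil => rfl
    | cons b l => simpa using ih

variable {d}

theorem walkWeight_nonneg (hd : ∀ a b, 0 ≤ d a b) (l : List α) : 0 ≤ walkWeight d l := by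
  induction l with
  | nil => simp
  | cons a l ih =>
    cases l with
    | nil => simp
    | cons b l => simpa using add_nonneg (hd a b) ih

theorem walkWeight_mono {d' : α → α → ℝ} (l : List α)
    (hd : ∀ a ∈ l, ∀ b ∈ l, d a b ≤ d' a b) : walkWeight d l ≤ walkWeight d' l := by
  induction l with
  | nil => simp
  | cons a l ih =>
    cases l with
    | nil => simp
    | cons b l =>
      exact add_le_add (hd _ (by simp) _ (by simp))
        (ih fun x hx y hy => hd x (List.mem_cons_of_mem _ hx) y (List.mem_cons_of_mem _ hy))

theorem walkWeight_add (d d' : α → α → ℝ) (l : List α) :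
    walkWeight (fun a b => d a b + d' a b) l = walkWeight d l + walkWeight d' l := by
  induction l with
  | nil => simp
  | cons a l ih =>
    cases l with
    | nil => simp
    | cons b l => simp only [walkWeight_cons_cons, ih]; ring

theorem walkWeight_append_le {l₁ l₂ : List α} {D : ℝ} (hD : 0 ≤ D)
    (h : ∀ a ∈ l₁, ∀ b ∈ l₂, d a b ≤ D) :
    walkWeight d (l₁ ++ l₂) ≤ walkWeight d l₁ + walkWeight d l₂ + D := by
  rcases l₂ with _ | ⟨b, l₂⟩
  · simpa using hD
  rcases List.eq_nil_or_concat l₁ with rfl | ⟨l, a, rfl⟩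
  · simpa using hD
  · have := h a (by simp) b (by simp)
    have e := walkWeight_append_cons_cons d l a b l₂
    rw [List.concat_eq_append, List.append_assoc, List.singleton_append, e]
    linarith

theorem walkWeight_le_length_mul {l : List α} {D : ℝ} (hD : 0 ≤ D)
    (h : ∀ a ∈ l, ∀ b ∈ l, d a b ≤ D) : walkWeight d l ≤ l.length * D := by
  induction l with
  | nil => simp
  | cons a l ih =>
    have h₁ := ih fun x hx y hy => h x (List.mem_cons_of_mem _ hx) y (List.mem_cons_of_mem _ hy)
    cases l with
    | nil => simpa using hD
    | cons b l =>
      have h₂ := h a (by simp) b (by simp)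
      simp only [walkWeight_cons_cons, List.length_cons, Nat.cast_add, Nat.cast_one] at h₁ ⊢
      linarith

/-- The end points of a walk are at most as far apart as the walk is long. -/
theorem dist_le_walkWeight (ht : ∀ a b c, d a c ≤ d a b + d b c)
    (l : List α) (x y : α) : d x y ≤ walkWeight d (x :: (l ++ [y])) := by
  induction l generalizing x with
  | nil => simp
  | cons a l ih => have := ih a; have := ht x a y; simp at *; linarith

end Walk

/-! ### Short orders for points of the plane -/

section Strips

variable {ι : Type*}

/-- Along a sorted list the coordinate travels monotonically. -/
theorem walkWeight_abs_of_pairwise (y : ι → ℝ) (l : List ι) (hl : l.Pairwise fun i j => y i ≤ y j)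
    {a b : ℝ} (hab : a ≤ b) (h : ∀ i ∈ l, a ≤ y i ∧ y i ≤ b) :
    walkWeight (fun i j => |y i - y j|) l ≤ b - a := by
  induction l generalizing a with
  | nil => simpa using hab
  | cons i l ih =>
    cases l with
    | nil => simpa using hab
    | cons j l =>
      rw [List.pairwise_cons] at hl
      have hij := hl.1 j (by simp)
      have h₁ := ih (a := y j) hl.2 (h j (by simp)).2 fun k hk =>
        ⟨by
          rcases List.mem_cons.1 hk with rfl | hk
          · exact le_rfl
          · exact List.rel_of_pairwise_cons hl.2 hk,
         (h k (List.mem_cons_of_mem _ hk)).2⟩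
      have h₂ := (h i (by simp)).1
      rw [walkWeight_cons_cons, abs_of_nonpos (by linarith)]
      linarith

theorem exists_perm_pairwise_le (y : ι → ℝ) (l : List ι) :
    ∃ l' : List ι, l'.Perm l ∧ l'.Pairwise fun i j => y i ≤ y j := by
  classical
  refine ⟨l.insertionSort (fun i j => y i ≤ y j), List.perm_insertionSort _ _, ?_⟩
  have : Std.Total (fun i j => y i ≤ y j) := ⟨fun i j => le_total _ _⟩
  have : IsTrans ι (fun i j => y i ≤ y j) := ⟨fun i j k => le_trans⟩
  exact List.pairwise_insertionSort _ _

/-- The distance in the `ℓ₁`-norm of the plane, for points with coordinates `x i` and `y i`. -/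
def planeDist (x y : ι → ℝ) (i j : ι) : ℝ := |x i - x j| + |y i - y j|

/-- Points in a box that are sorted by their abscissa are cut into `q` strips with at most `k` points
each; the strips are visited one after the other, each from the bottom to the top. -/
theorem exists_perm_walkWeight_le_of_pairwise (x y : ι → ℝ) (k : ℕ) {b c e M : ℝ} (hce : c ≤ e)
    (q : ℕ) (l : List ι) (hl : l.Pairwise fun i j => x i ≤ x j) (hlen : l.length ≤ k * q)
    {a : ℝ} (hab : a ≤ b) (hM : (b - a) + (e - c) ≤ M) (hx : ∀ i ∈ l, a ≤ x i ∧ x i ≤ b)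
    (hy : ∀ i ∈ l, c ≤ y i ∧ y i ≤ e) :
    ∃ l', l'.Perm l ∧ walkWeight (planeDist x y) l' ≤ k * (b - a) + q * ((e - c) + M) := by
  -- The left border `a` moves to the right as strips are removed. `M` stays fixed: it bounds the
  -- diameter of the first box, hence every jump between strips.
  induction q generalizing l a with
  | zero =>
    have : l = [] := List.length_eq_zero_iff.1 (by simpa using hlen)
    subst this
    exact ⟨[], List.Perm.refl _, by
      have : 0 ≤ (k : ℝ) * (b - a) := mul_nonneg (Nat.cast_nonneg _) (by linarith)
      simpa using this⟩
  | succ q ih =>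
    have hsplit : l.take k ++ l.drop k = l := List.take_append_drop k l
    -- `t` is the border between the first strip and the rest: the abscissa of the first remaining
    -- point, or `b` if no point remains.
    obtain ⟨t, hat, htb, ht₁, ht₂⟩ : ∃ t, a ≤ t ∧ t ≤ b ∧ (∀ i ∈ l.take k, x i ≤ t) ∧
        ∀ i ∈ l.drop k, t ≤ x i := by
      rcases hd : l.drop k with _ | ⟨j, r⟩
      · exact ⟨b, hab, le_rfl, fun i hi => (hx i (List.mem_of_mem_take hi)).2, by simp⟩
      · have hj : j ∈ l := List.mem_of_mem_drop (i := k) (by rw [hd]; simp)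
        rw [← hsplit, hd, List.pairwise_append] at hl
        refine ⟨x j, (hx j hj).1, (hx j hj).2, fun i hi => hl.2.2 i hi j (by simp), ?_⟩
        intro i hi
        rcases List.mem_cons.1 hi with rfl | hi
        · exact le_rfl
        · exact List.rel_of_pairwise_cons hl.2.1 hi
    obtain ⟨r, hr, hrw⟩ := ih (l.drop k) (hl.sublist (List.drop_sublist _ _))
      (by rw [List.length_drop]; have : k * (q + 1) = k * q + k := by ring
          omega) htb (by linarith)
      (fun i hi => ⟨ht₂ i hi, (hx i (List.mem_of_mem_drop hi)).2⟩)
      (fun i hi => hy i (List.mem_of_mem_drop hi))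
    obtain ⟨s, hs, hsw⟩ := exists_perm_pairwise_le y (l.take k)
    have hs' : ∀ i ∈ s, i ∈ l.take k := fun i hi => hs.mem_iff.1 hi
    have hsl : ∀ i ∈ s, i ∈ l := fun i hi => List.mem_of_mem_take (hs' i hi)
    have hrl : ∀ i ∈ r, i ∈ l := fun i hi => List.mem_of_mem_drop (hr.mem_iff.1 hi)
    refine ⟨s ++ r, by rw [← hsplit]; simpa using hs.append hr, ?_⟩
    -- Within the strip each of the at most `k` moves changes the abscissa by at most its width,
    -- while the ordinate only increases.
    have h₁ : walkWeight (planeDist x y) s ≤ k * (t - a) + (e - c) := by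
      unfold planeDist
      rw [walkWeight_add]
      refine add_le_add ?_ (walkWeight_abs_of_pairwise y s hsw hce fun i hi => hy i (hsl i hi))
      refine (walkWeight_le_length_mul (D := t - a) (by linarith) ?_).trans ?_
      · intro i hi j hj
        have := (hx i (hsl i hi)).1
        have := (hx j (hsl j hj)).1
        have := ht₁ i (hs' i hi)
        have := ht₁ j (hs' j hj)
        rw [abs_le]; constructor <;> linarith
      · refine mul_le_mul_of_nonneg_right ?_ (by linarith)
        rw [hs.length_eq, List.length_take]
        exact_mod_cast min_le_left _ _
    have h₂ := walkWeight_append_le (d := planeDist x y) (l₁ := s) (l₂ := r) (D := M) (by linarith) <| by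
      intro i hi j hj
      have h1 := hx i (hsl i hi)
      have h2 := hx j (hrl j hj)
      have h3 := hy i (hsl i hi)
      have h4 := hy j (hrl j hj)
      have h5 : |x i - x j| ≤ b - a := by rw [abs_le]; constructor <;> linarith
      have h6 : |y i - y j| ≤ e - c := by rw [abs_le]; constructor <;> linarith
      exact (add_le_add h5 h6).trans hM
    push_cast
    linarith

/-- At most `k ^ 2` points in a square can be visited on a walk that is `4 * k` times as long as the
side of the square. -/
theorem exists_perm_walkWeight_le (x y : ι → ℝ) (k : ℕ) (l : List ι) (hlen : l.length ≤ k * k)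
    {a b : ℝ} (hab : a ≤ b) (hx : ∀ i ∈ l, a ≤ x i ∧ x i ≤ b) (hy : ∀ i ∈ l, a ≤ y i ∧ y i ≤ b) :
    ∃ l', l'.Perm l ∧ walkWeight (planeDist x y) l' ≤ 4 * k * (b - a) := by
  obtain ⟨s, hs, hsw⟩ := exists_perm_pairwise_le x l
  -- With `k` strips and `M` equal to two sides, the bound is `k + k * (1 + 2) = 4 * k` sides.
  obtain ⟨r, hr, hrw⟩ := exists_perm_walkWeight_le_of_pairwise x y k hab k s hsw
    (by rwa [hs.length_eq]) hab le_rfl (fun i hi => hx i (hs.mem_iff.1 hi))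
    fun i hi => hy i (hs.mem_iff.1 hi)
  exact ⟨r, hr.trans hs, hrw.trans (le_of_eq (by ring))⟩

end Strips

/-! ### Short orders for families of intervals -/

section Intervals

variable {ι : Type*} [DecidableEq ι]

/-- Intervals with end points among the points `f 0 ≤ f 1 ≤ …` of a line, such that every point is
covered by few of them, have an order in which the starting points and the end points both are visited
on a short walk. -/
theorem exists_order_of_depth_le (f : ℕ → ℝ) (hf : Monotone f) (α β : ι → ℕ) {c k : ℕ}
    (hck : c ≤ k * k) (n : ℕ) (J : Finset ι) (hJ : J.card < 2 ^ n) (hαβ : ∀ j ∈ J, α j < β j)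
    (hdepth : ∀ p, (J.filter fun j => α j ≤ p ∧ p < β j).card ≤ c) {u v : ℕ} (huv : u ≤ v)
    (hu : ∀ j ∈ J, u ≤ α j) (hv : ∀ j ∈ J, β j ≤ v) :
    ∃ L : List ι, L.Nodup ∧ L.toFinset = J ∧
      walkWeight (planeDist (f ∘ α) (f ∘ β)) L ≤ (4 * k + 4) * n * (f v - f u) := by
  induction n generalizing J u v with
  | zero =>
    have : J = ∅ := Finset.card_eq_zero.1 (by simpa using hJ)
    exact ⟨[], List.nodup_nil, by simp [this], by simp⟩
  | succ n ih =>
    have hfuv : 0 ≤ f v - f u := sub_nonneg.2 (hf huv)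
    rcases J.eq_empty_or_nonempty with rfl | hne
    · exact ⟨[], List.nodup_nil, by simp, by
        simp only [walkWeight_nil]; exact mul_nonneg (by positivity) hfuv⟩
    have hpos := hne.card_pos
    -- The cut `p` is the least point such that more than half of the intervals start at or before
    -- `p`. By minimality at most half start strictly before it.
    have hex : ∃ p, J.card < 2 * (J.filter fun j => α j ≤ p).card := by
      refine ⟨v, ?_⟩
      rw [Finset.filter_true_of_mem fun j hj => (hαβ j hj).le.trans (hv j hj)]
      omega
    classical
    obtain ⟨p, hp, hmin⟩ : ∃ p, J.card < 2 * (J.filter fun j => α j ≤ p).card ∧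
        ∀ p' < p, ¬ J.card < 2 * (J.filter fun j => α j ≤ p').card :=
      ⟨Nat.find hex, Nat.find_spec hex, fun p' => Nat.find_min hex⟩
    have hlow : 2 * (J.filter fun j => α j < p).card ≤ J.card := by
      rcases Nat.eq_zero_or_pos p with rfl | h0
      · simp
      · have := hmin (p - 1) (by omega)
        have e : (J.filter fun j => α j ≤ p - 1) = J.filter fun j => α j < p :=
          Finset.filter_congr fun j _ => by omega
        rw [e] at this; omega
    obtain ⟨j₀, hj₀, hj₀p⟩ : ∃ j ∈ J, α j ≤ p := by
      have : 0 < (J.filter fun j => α j ≤ p).card := by omega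
      obtain ⟨j, hj⟩ := Finset.card_pos.1 this
      exact ⟨j, (Finset.mem_filter.1 hj).1, (Finset.mem_filter.1 hj).2⟩
    have hup : u ≤ p := (hu j₀ hj₀).trans hj₀p
    have hpv : p ≤ v := by
      by_contra h
      have := hmin v (by omega)
      rw [Finset.filter_true_of_mem fun j hj => (hαβ j hj).le.trans (hv j hj)] at this
      omega
    -- `A` and `B` have fewer than `2 ^ n` members and live in `[u, p]` and `[p, v]`. All intervals
    -- of `X` contain `p`, so the depth bound applies to their number.
    set A := J.filter fun j => β j ≤ p with hA
    set X := J.filter fun j => α j ≤ p ∧ p < β j with hX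
    set B := J.filter fun j => p < α j with hB
    have h2 : 2 ^ (n + 1) = 2 * 2 ^ n := by ring
    have hAcard : A.card < 2 ^ n := by
      have : A.card ≤ (J.filter fun j => α j < p).card :=
        Finset.card_le_card fun j hj => by
          rw [hA, Finset.mem_filter] at hj
          exact Finset.mem_filter.2 ⟨hj.1, (hαβ j hj.1).trans_le hj.2⟩
      omega
    have hBcard : B.card < 2 ^ n := by
      have h3 := Finset.card_filter_add_card_filter_not (s := J) (fun j => α j ≤ p)
      have : (J.filter fun j => ¬ α j ≤ p) = B := Finset.filter_congr fun j _ => by simp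
      rw [this] at h3; omega
    have hsub : ∀ (q : ι → Prop) [DecidablePred q] (p' : ℕ),
        ((J.filter q).filter fun j => α j ≤ p' ∧ p' < β j).card ≤ c := fun q _ p' =>
      (Finset.card_le_card (Finset.filter_subset_filter _ (Finset.filter_subset _ _))).trans
        (hdepth p')
    obtain ⟨LA, hLA, hLA', hLAw⟩ := ih A hAcard (fun j hj => hαβ j (Finset.mem_filter.1 hj).1)
      (hsub _) hup (fun j hj => hu j (Finset.mem_filter.1 hj).1)
      (fun j hj => (Finset.mem_filter.1 hj).2)
    obtain ⟨LB, hLB, hLB', hLBw⟩ := ih B hBcard (fun j hj => hαβ j (Finset.mem_filter.1 hj).1)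
      (hsub _) hpv (fun j hj => (Finset.mem_filter.1 hj).2.le)
      (fun j hj => hv j (Finset.mem_filter.1 hj).1)
    have hbox : ∀ j ∈ J, (f u ≤ f (α j) ∧ f (α j) ≤ f v) ∧ (f u ≤ f (β j) ∧ f (β j) ≤ f v) :=
      fun j hj => ⟨⟨hf (hu j hj), hf ((hαβ j hj).le.trans (hv j hj))⟩,
        ⟨hf ((hu j hj).trans (hαβ j hj).le), hf (hv j hj)⟩⟩
    obtain ⟨LX, hLX, hLXw⟩ := exists_perm_walkWeight_le (f ∘ α) (f ∘ β) k X.toList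
      (by rw [Finset.length_toList]; exact (hdepth p).trans hck) (hf huv)
      (fun j hj => (hbox j (Finset.mem_filter.1 (Finset.mem_toList.1 hj)).1).1)
      (fun j hj => (hbox j (Finset.mem_filter.1 (Finset.mem_toList.1 hj)).1).2)
    have mA : ∀ j, j ∈ LA ↔ j ∈ J ∧ β j ≤ p := fun j => by
      rw [← List.mem_toFinset, hLA', hA, Finset.mem_filter]
    have mB : ∀ j, j ∈ LB ↔ j ∈ J ∧ p < α j := fun j => by
      rw [← List.mem_toFinset, hLB', hB, Finset.mem_filter]
    have mX : ∀ j, j ∈ LX ↔ j ∈ J ∧ α j ≤ p ∧ p < β j := fun j => by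
      rw [hLX.mem_iff, Finset.mem_toList, hX, Finset.mem_filter]
    have jump : ∀ i ∈ J, ∀ j ∈ J, planeDist (f ∘ α) (f ∘ β) i j ≤ 2 * (f v - f u) := by
      intro i hi j hj
      have h1 := hbox i hi
      have h2 := hbox j hj
      have h5 : |f (α i) - f (α j)| ≤ f v - f u := by rw [abs_le]; constructor <;> linarith
      have h6 : |f (β i) - f (β j)| ≤ f v - f u := by rw [abs_le]; constructor <;> linarith
      simp only [planeDist, Function.comp]
      linarith
    refine ⟨(LA ++ LX) ++ LB, ?_, ?_, ?_⟩
    · rw [List.nodup_append, List.nodup_append]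
      refine ⟨⟨hLA, hLX.nodup_iff.2 (Finset.nodup_toList _), ?_⟩, hLB, ?_⟩
      · rintro i hi _ hj rfl
        rw [mA] at hi; rw [mX] at hj; omega
      · rintro i hi _ hj rfl
        rw [mB] at hj
        have := hαβ i hj.1
        rcases List.mem_append.1 hi with hi | hi
        · rw [mA] at hi; omega
        · rw [mX] at hi; omega
    · ext j
      simp only [List.mem_toFinset, List.mem_append, mA, mB, mX]
      constructor
      · rintro ((h | h) | h) <;> exact h.1
      · intro h
        by_cases h1 : β j ≤ p
        · exact Or.inl (Or.inl ⟨h, h1⟩)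
        · by_cases h2 : α j ≤ p
          · exact Or.inl (Or.inr ⟨h, h2, by omega⟩)
          · exact Or.inr ⟨h, by omega⟩
    · have hD : 0 ≤ 2 * (f v - f u) := by linarith
      have e₁ := walkWeight_append_le (d := planeDist (f ∘ α) (f ∘ β)) (l₁ := LA ++ LX) (l₂ := LB) hD
        fun i hi j hj => jump i (by
          rcases List.mem_append.1 hi with hi | hi
          · exact ((mA i).1 hi).1
          · exact ((mX i).1 hi).1) j ((mB j).1 hj).1
      have e₂ := walkWeight_append_le (d := planeDist (f ∘ α) (f ∘ β)) (l₁ := LA) (l₂ := LX) hD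
        fun i hi j hj => jump i ((mA i).1 hi).1 j ((mX j).1 hj).1
      -- The two recursive bounds add up to `n` levels over the full range. The new level costs `4 *
      -- k` for `X` and `2` for each of the two jumps between the three parts.
      have e₃ : (4 * k + 4) * n * (f p - f u) + (4 * k + 4) * n * (f v - f p) =
        (4 * k + 4) * n * (f v - f u) := by ring
      push_cast
      linarith

end Intervals

/-! ### Distances between points of a walk -/

section Walk

variable {α : Type*} {d : α → α → ℝ}

theorem walkWeight_le_of_isPrefix (hd : ∀ a b, 0 ≤ d a b) {l₁ l₂ : List α} (h : l₁ <+: l₂) :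
    walkWeight d l₁ ≤ walkWeight d l₂ := by
  obtain ⟨l, rfl⟩ := h
  rcases List.eq_nil_or_concat l₁ with rfl | ⟨r, a, rfl⟩
  · exact walkWeight_nonneg hd _
  · rw [List.concat_eq_append, List.append_assoc, List.singleton_append, walkWeight_append_cons d r a l]
    have := walkWeight_nonneg hd (a :: l)
    linarith

/-- Two points of a walk are at most as far apart as the part of the walk between them is long. -/
theorem dist_getElem_le (h₀ : ∀ a, d a a = 0)
    (ht : ∀ a b c, d a c ≤ d a b + d b c) (o : α) (l : List α) {p q : ℕ} (hpq : p ≤ q)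
    (hq : q < l.length) :
    d l[p] l[q] ≤ walkWeight d (o :: l.take (q + 1)) - walkWeight d (o :: l.take (p + 1)) := by
  rcases hpq.eq_or_lt with rfl | hlt
  · simp [h₀]
  have hp : p < l.length := by omega
  have e₁ : l.take (q + 1) = l.take p ++ l[p] :: ((l.drop (p + 1)).take (q - p - 1) ++ [l[q]]) := by
    have h1 : l.take (q + 1) = l.take (p + 1) ++ (l.drop (p + 1)).take (q - p) := by
      rw [← List.take_add]; congr 1; omega
    have h2 : (l.drop (p + 1)).take (q - p) = (l.drop (p + 1)).take (q - p - 1) ++ [l[q]] := by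
      have h3 : q - p = (q - p - 1) + 1 := by omega
      conv_lhs => rw [h3]
      rw [← List.take_append_getElem (by rw [List.length_drop]; omega), List.getElem_drop]
      congr 3; omega
    rw [h1, h2, ← List.take_append_getElem hp, List.append_assoc]
    rfl
  have e₂ : l.take (p + 1) = l.take p ++ [l[p]] := (List.take_append_getElem hp).symm
  have e₃ := walkWeight_append_cons d (o :: l.take p) l[p]
    ((l.drop (p + 1)).take (q - p - 1) ++ [l[q]])
  have e₄ := dist_le_walkWeight ht ((l.drop (p + 1)).take (q - p - 1)) l[p] l[q]
  rw [e₁, e₂]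
  simp only [List.cons_append] at e₃
  linarith

theorem dist_start_le (ht : ∀ a b c, d a c ≤ d a b + d b c) (o : α) (l : List α) {p : ℕ}
    (hp : p < l.length) : d o l[p] ≤ walkWeight d (o :: l.take (p + 1)) := by
  rw [← List.take_append_getElem hp]
  exact dist_le_walkWeight ht _ _ _

end Walk

/-! ### Routes measured by distance travelled; lower bounds from a feasible solution -/

namespace Instance

variable (I : Instance)

theorem w_nonneg (a b : Fin I.n) : 0 ≤ I.w a b := by
  have h1 := I.w_triangle a b a
  have h2 := I.w_self a
  have h3 := I.w_symm a b
  linarith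

/-- The weight of the route of one vehicle. -/
noncomputable def routeWeight (i : Fin I.h) (l : List (Stop I.n I.m)) : ℝ :=
  walkWeight I.w (I.depot i :: l.map I.loc)

theorem routeWeight_nonneg (i : Fin I.h) (l : List (Stop I.n I.m)) : 0 ≤ I.routeWeight i l :=
  walkWeight_nonneg I.w_nonneg _

theorem weight_eq (R : I.Routes) : I.weight R = ∑ i, I.routeWeight i (R i) := rfl

theorem countP_isPickup (l : List (Stop I.n I.m)) :
    l.countP Stop.isPickup = ∑ j, l.count (.pickup j) := by
  induction l with
  | nil => simp
  | cons a l ih =>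
    simp only [List.countP_cons, List.count_cons, Finset.sum_add_distrib, ih]
    cases a <;> simp [Stop.isPickup]

theorem countP_isDelivery (l : List (Stop I.n I.m)) :
    l.countP Stop.isDelivery = ∑ j, l.count (.deliver j) := by
  induction l with
  | nil => simp
  | cons a l ih =>
    simp only [List.countP_cons, List.count_cons, Finset.sum_add_distrib, ih]
    cases a <;> simp [Stop.isDelivery]

/-- The requests that are picked up on a route. -/
def served (l : List (Stop I.n I.m)) : Finset (Fin I.m) :=
  Finset.univ.filter fun j => Stop.pickup j ∈ l

theorem mem_served {l : List (Stop I.n I.m)} {j : Fin I.m} : j ∈ I.served l ↔ .pickup j ∈ l := by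
  simp [served]

/-- How far the vehicle has travelled along its route after `p + 1` stops. -/
noncomputable def position (i : Fin I.h) (l : List (Stop I.n I.m)) (p : ℕ) : ℝ :=
  I.routeWeight i (l.take (p + 1))

theorem position_mono (i : Fin I.h) (l : List (Stop I.n I.m)) : Monotone (I.position i l) := by
  intro p q hpq
  refine walkWeight_le_of_isPrefix I.w_nonneg ?_
  rw [List.prefix_cons_inj]
  exact (List.take_prefix_take_left (by omega)).map _

theorem position_nonneg (i : Fin I.h) (l : List (Stop I.n I.m)) (p : ℕ) : 0 ≤ I.position i l p :=
  I.routeWeight_nonneg _ _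

theorem position_le (i : Fin I.h) (l : List (Stop I.n I.m)) (p : ℕ) :
    I.position i l p ≤ I.routeWeight i l := by
  refine walkWeight_le_of_isPrefix I.w_nonneg ?_
  rw [List.prefix_cons_inj]
  exact (List.take_prefix _ _).map _

theorem w_loc_le (i : Fin I.h) (l : List (Stop I.n I.m)) {a b : Stop I.n I.m} (hb : b ∈ l)
    (hab : l.idxOf a ≤ l.idxOf b) :
    I.w (I.loc a) (I.loc b) ≤ I.position i l (l.idxOf b) - I.position i l (l.idxOf a) := by
  have h := dist_getElem_le I.w_self I.w_triangle (I.depot i) (l.map I.loc) hab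
    (by rw [List.length_map]; exact List.idxOf_lt_length_of_mem hb)
  simpa [position, routeWeight, List.map_take] using h

theorem w_depot_loc_le (i : Fin I.h) (l : List (Stop I.n I.m)) {a : Stop I.n I.m} (ha : a ∈ l) :
    I.w (I.depot i) (I.loc a) ≤ I.position i l (l.idxOf a) := by
  have h := dist_start_le I.w_triangle (I.depot i) (l.map I.loc) (p := l.idxOf a)
    (by rw [List.length_map]; exact List.idxOf_lt_length_of_mem ha)
  simpa [position, routeWeight, List.map_take] using h

/-- Used for sources and for destinations, this embeds the requests of one route into the plane:
their distance in `H` is at most the ℓ₁-distance of their pairs of positions. -/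
theorem w_loc_le_abs (i : Fin I.h) (l : List (Stop I.n I.m)) {a b : Stop I.n I.m} (ha : a ∈ l)
    (hb : b ∈ l) :
    I.w (I.loc a) (I.loc b) ≤ |I.position i l (l.idxOf a) - I.position i l (l.idxOf b)| := by
  rcases le_total (l.idxOf a) (l.idxOf b) with h | h
  · rw [abs_sub_comm]
    exact (I.w_loc_le i l hb h).trans (le_abs_self _)
  · rw [I.w_symm]
    exact (I.w_loc_le i l ha h).trans (le_abs_self _)

variable {I} {R : I.Routes}

namespace IsFeasible

variable (hR : I.IsFeasible R) (i : Fin I.h)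

include hR

theorem deliver_mem {j : Fin I.m} (hj : j ∈ I.served (R i)) : .deliver j ∈ R i := by
  rw [mem_served, ← List.count_pos_iff] at hj
  rw [← List.count_pos_iff, hR.same_vehicle]
  exact hj

/-- The order condition is applied to the prefix that ends with the first delivery of `j`: it must
contain a pickup of `j`. -/
theorem idxOf_lt {j : Fin I.m} (hj : j ∈ I.served (R i)) :
    (R i).idxOf (.pickup j) < (R i).idxOf (.deliver j) := by
  have hd := hR.deliver_mem i hj
  have hlt := List.idxOf_lt_length_of_mem hd
  have h1 : Stop.deliver j ∈ (R i).take ((R i).idxOf (.deliver j) + 1) :=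
    (List.mem_take_iff_idxOf_lt hd).2 (Nat.lt_succ_self _)
  have h2 := hR.order i j _ (List.take_prefix ((R i).idxOf (.deliver j) + 1) _)
  have h3 := List.count_pos_iff.1 ((List.count_pos_iff.2 h1).trans_le h2)
  have h4 := (List.mem_take_iff_idxOf_lt (I.mem_served.1 hj)).1 h3
  refine lt_of_le_of_ne (by omega) fun h => ?_
  have h5 := List.getElem_idxOf (List.idxOf_lt_length_of_mem (I.mem_served.1 hj))
  have h6 := List.getElem_idxOf hlt
  simp only [h] at h5
  rw [h6] at h5
  cases h5

/-- At most `cap` items are on board between two consecutive stops. -/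
theorem depth_le (p : ℕ) :
    ((I.served (R i)).filter fun j =>
      (R i).idxOf (.pickup j) ≤ p ∧ p < (R i).idxOf (.deliver j)).card ≤ I.cap := by
  set l := (R i).take (p + 1) with hl
  have hcap := hR.capacity i l (List.take_prefix _ _)
  rw [countP_isPickup, countP_isDelivery] at hcap
  -- Stated with sums instead of differences, the claim splits over the requests: an item on board
  -- has a pickup and no delivery in the prefix, any other item has at most as many deliveries as
  -- pickups.
  suffices h : ((I.served (R i)).filter fun j =>
      (R i).idxOf (.pickup j) ≤ p ∧ p < (R i).idxOf (.deliver j)).card +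
      ∑ j, l.count (.deliver j) ≤ ∑ j, l.count (.pickup j) by omega
  have hsub : ((I.served (R i)).filter fun j =>
      (R i).idxOf (.pickup j) ≤ p ∧ p < (R i).idxOf (.deliver j)).card ≤
      ∑ j, if j ∈ I.served (R i) ∧ (R i).idxOf (.pickup j) ≤ p ∧ p < (R i).idxOf (.deliver j)
        then 1 else 0 := by
    rw [Finset.sum_boole, Nat.cast_id]
    exact Finset.card_le_card fun j hj => by simpa using hj
  refine (Nat.add_le_add_right hsub _).trans ?_
  rw [← Finset.sum_add_distrib]
  refine Finset.sum_le_sum fun j _ => ?_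
  split_ifs with h
  · have h1 : 0 < l.count (.pickup j) := List.count_pos_iff.2
      ((List.mem_take_iff_idxOf_lt (I.mem_served.1 h.1)).2 (by omega))
    have h2 : l.count (.deliver j) = 0 := List.count_eq_zero.2 fun hm => by
      have := (List.mem_take_iff_idxOf_lt (hR.deliver_mem i h.1)).1 hm
      omega
    omega
  · rw [Nat.zero_add]
    exact hR.order i j l (List.take_prefix _ _)

/-- Every vehicle carries at most `cap` items, so the weight of its route is at least the average of
the distances over which the items have to be carried. -/
theorem sum_w_le_cap_mul :
    ∑ j ∈ I.served (R i), I.w (I.src j) (I.dst j) ≤ I.cap * I.routeWeight i (R i) := by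
  set f := I.position i (R i) with hf
  set α := fun j : Fin I.m => (R i).idxOf (.pickup j) with hα
  set β := fun j : Fin I.m => (R i).idxOf (.deliver j) with hβ
  set N := (R i).length
  -- The haul is at most the distance travelled between pickup and delivery, a telescoping sum of
  -- steps. After exchanging the sums, `depth_le` bounds how often a step is charged.
  have h1 : ∀ j ∈ I.served (R i), I.w (I.src j) (I.dst j) ≤
      ∑ p ∈ Finset.range N, if α j ≤ p ∧ p < β j then f (p + 1) - f p else 0 := by
    intro j hj
    have hd := hR.deliver_mem i hj
    have hβN : β j < N := List.idxOf_lt_length_of_mem hd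
    have hαβ : α j ≤ β j := (hR.idxOf_lt i hj).le
    refine (I.w_loc_le i (R i) hd hαβ).trans (le_of_eq ?_)
    rw [← Finset.sum_filter]
    have : (Finset.range N).filter (fun p => α j ≤ p ∧ p < β j) = Finset.Ico (α j) (β j) := by
      ext p
      simp only [Finset.mem_filter, Finset.mem_range, Finset.mem_Ico]
      constructor
      · exact fun h => h.2
      · exact fun h => ⟨by omega, h⟩
    rw [this, Finset.sum_Ico_sub _ hαβ]
  refine (Finset.sum_le_sum h1).trans ?_
  rw [Finset.sum_comm]
  have h2 : ∀ p ∈ Finset.range N, (∑ j ∈ I.served (R i),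
      if α j ≤ p ∧ p < β j then f (p + 1) - f p else 0) ≤ I.cap * (f (p + 1) - f p) := by
    intro p _
    rw [← Finset.sum_filter, Finset.sum_const, nsmul_eq_mul]
    refine mul_le_mul_of_nonneg_right (by exact_mod_cast hR.depth_le i p) ?_
    exact sub_nonneg.2 (I.position_mono i _ (Nat.le_succ p))
  refine (Finset.sum_le_sum h2).trans ?_
  rw [← Finset.mul_sum, Finset.sum_range_sub]
  refine mul_le_mul_of_nonneg_left ?_ (Nat.cast_nonneg _)
  have := I.position_nonneg i (R i) 0
  have := I.position_le i (R i) N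
  linarith

/-- The requests of a vehicle have an order that makes for a short tour in `H`. -/
theorem exists_tour {k : ℕ} (hk : I.cap ≤ k * k) {n : ℕ} (hn : I.m < 2 ^ n) :
    ∃ L : List (Fin I.m), L.Nodup ∧ L.toFinset = I.served (R i) ∧
      tourWeight I.wH (Sum.inl i :: L.map Sum.inr) ≤
        ((4 * k + 4) * n + 4) * I.routeWeight i (R i) := by
  set f := I.position i (R i) with hf
  set α := fun j : Fin I.m => (R i).idxOf (.pickup j) with hα
  set β := fun j : Fin I.m => (R i).idxOf (.deliver j) with hβ
  set N := (R i).length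
  obtain ⟨L, hL, hLJ, hLw⟩ := exists_order_of_depth_le f (I.position_mono i _) α β hk n
    (I.served (R i))
    (((Finset.card_le_univ _).trans_eq (Fintype.card_fin _)).trans_lt hn)
    (fun j hj => hR.idxOf_lt i hj) (fun p => hR.depth_le i p) (Nat.zero_le N)
    (fun _ _ => Nat.zero_le _) fun j hj =>
      (List.idxOf_lt_length_of_mem (hR.deliver_mem i hj)).le
  refine ⟨L, hL, hLJ, ?_⟩
  have hW := I.routeWeight_nonneg i (R i)
  have hmem : ∀ j ∈ L, j ∈ I.served (R i) := fun j hj => by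
    rw [← hLJ]; exact List.mem_toFinset.2 hj
  have hs : ∀ j ∈ L, I.wH (Sum.inl i) (Sum.inr j) ≤ 2 * I.routeWeight i (R i) := by
    intro j hj
    have h1 := I.w_depot_loc_le i (R i) (I.mem_served.1 (hmem j hj))
    have h2 := I.w_depot_loc_le i (R i) (hR.deliver_mem i (hmem j hj))
    have h3 := I.position_le i (R i) ((R i).idxOf (.pickup j))
    have h4 := I.position_le i (R i) ((R i).idxOf (.deliver j))
    simp only [loc, wH] at h1 h2 ⊢
    linarith
  have hself : I.wH (Sum.inl i) (Sum.inl i) ≤ 2 * I.routeWeight i (R i) := by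
    simp only [wH, I.w_self]; linarith
  have hpath : walkWeight I.wH (L.map Sum.inr) ≤ (4 * k + 4) * n * I.routeWeight i (R i) := by
    rw [walkWeight_map]
    refine (walkWeight_mono L ?_).trans (hLw.trans ?_)
    · intro a ha b hb
      exact add_le_add
        (I.w_loc_le_abs i (R i) (I.mem_served.1 (hmem a ha)) (I.mem_served.1 (hmem b hb)))
        (I.w_loc_le_abs i (R i) (hR.deliver_mem i (hmem a ha)) (hR.deliver_mem i (hmem b hb)))
    · refine mul_le_mul_of_nonneg_left ?_ (by positivity)
      have := I.position_nonneg i (R i) 0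
      have := I.position_le i (R i) N
      linarith
  -- The edges from and to the depot cost at most two route weights each; they make up the final `+
  -- 4`. The case of an empty tour explains why the loop at the depot is bounded too.
  have e₁ := walkWeight_append_le (d := I.wH) (l₁ := [Sum.inl i]) (l₂ := L.map Sum.inr ++ [Sum.inl i])
    (D := 2 * I.routeWeight i (R i)) (by linarith) (by
      intro a ha b hb
      rw [List.mem_singleton.1 ha]
      rcases List.mem_append.1 hb with hb | hb
      · obtain ⟨j, hj, rfl⟩ := List.mem_map.1 hb
        exact hs j hj
      · rw [List.mem_singleton.1 hb]; exact hself)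
  have e₂ := walkWeight_append_le (d := I.wH) (l₁ := L.map Sum.inr) (l₂ := [Sum.inl i])
    (D := 2 * I.routeWeight i (R i)) (by linarith) (by
      intro a ha b hb
      rw [List.mem_singleton.1 hb]
      obtain ⟨j, hj, rfl⟩ := List.mem_map.1 ha
      exact hs j hj)
  simp only [walkWeight_singleton, List.singleton_append] at e₁ e₂
  simp only [tourWeight]
  linarith

/-- The sets of requests picked up by the vehicles partition all requests. This combines the bounds
for single routes. -/
theorem sum_mem_served (F : Fin I.m → ℝ) : ∑ i, ∑ j ∈ I.served (R i), F j = ∑ j, F j := by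
  simp only [served, Finset.sum_filter]
  rw [Finset.sum_comm]
  refine Finset.sum_congr rfl fun j _ => ?_
  obtain ⟨i, hi, h0⟩ : ∃ i, (R i).count (.pickup j) ≠ 0 ∧
      ∀ i', i' ≠ i → (R i').count (.pickup j) = 0 := by
    have h := hR.pickup_once j
    obtain ⟨i, -, hi⟩ := Finset.exists_ne_zero_of_sum_ne_zero (h.trans_ne one_ne_zero)
    refine ⟨i, hi, fun i' hne => ?_⟩
    rw [← Finset.add_sum_erase _ _ (Finset.mem_univ i)] at h
    have h2 : ∑ x ∈ Finset.univ.erase i, (R x).count (.pickup j) = 0 := by omega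
    exact Finset.sum_eq_zero_iff.1 h2 i' (Finset.mem_erase.2 ⟨hne, Finset.mem_univ _⟩)
  rw [Finset.sum_eq_single i]
  · rw [if_pos (List.count_pos_iff.1 (Nat.pos_of_ne_zero hi))]
  · intro i' _ hne
    rw [if_neg (List.count_eq_zero.1 (h0 i' hne))]
  · simp

theorem sum_w_le : ∑ j, I.w (I.src j) (I.dst j) ≤ I.cap * I.weight R := by
  rw [← hR.sum_mem_served, weight_eq, Finset.mul_sum]
  exact Finset.sum_le_sum fun i _ => hR.sum_w_le_cap_mul i

/-- From a feasible solution one obtains a cheap solution of the multi-depot TSP. -/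
theorem exists_isMTSP {k : ℕ} (hk : I.cap ≤ k * k) {n : ℕ} (hn : I.m < 2 ^ n) :
    ∃ S : I.Tours, I.IsMTSP S ∧ I.mtspWeight S ≤ ((4 * k + 4) * n + 4) * I.weight R := by
  choose S hS hSJ hSw using fun i => hR.exists_tour i hk hn
  refine ⟨S, fun j => ?_, ?_⟩
  · have h := hR.sum_mem_served fun j' => if j' = j then 1 else 0
    rw [Finset.sum_ite_eq' Finset.univ j, if_pos (Finset.mem_univ _)] at h
    have h' : ∀ i, (∑ j' ∈ I.served (R i), if j' = j then (1 : ℝ) else 0) = (S i).count j := by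
      intro i
      rw [Finset.sum_ite_eq', ← hSJ]
      split_ifs with hj
      · rw [List.count_eq_one_of_mem (hS i) (List.mem_toFinset.1 hj), Nat.cast_one]
      · rw [List.count_eq_zero.2 fun hm => hj (List.mem_toFinset.2 hm), Nat.cast_zero]
    simp only [h'] at h
    exact_mod_cast h
  · rw [weight_eq, Finset.mul_sum]
    exact Finset.sum_le_sum fun i _ => hSw i

end IsFeasible

end Instance

theorem walkWeight_concat_append_cons {α : Type*} (d : α → α → ℝ) (l₁ : List α) (a b : α)
    (l₂ : List α) : walkWeight d ((l₁ ++ [a]) ++ b :: l₂) =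
      walkWeight d (l₁ ++ [a]) + d a b + walkWeight d (b :: l₂) := by
  rw [List.append_assoc, List.singleton_append, walkWeight_append_cons_cons]

namespace Instance

/-! ### Cutting a list into fragments -/

section Fragments

variable {α : Type*}

/-- The list is cut into pieces of length `c`, the last one possibly shorter. -/
def chunks (c : ℕ) (L : List α) : List (List α) :=
  (List.range (L.length ⌈/⌉ c)).map fun k => (L.drop (c * k)).take c

theorem fragments_eq (c θ : ℕ) (L : List α) :
    fragments c θ L = L.take θ :: chunks c (L.drop θ) := by
  simp [fragments, chunks, List.length_drop, List.drop_drop]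

@[simp] theorem chunks_nil (c : ℕ) : chunks c ([] : List α) = [] := by
  simp [chunks]

/-- Replaces the explicit formula with the rounded-up number of pieces by a recursion, on which all
later inductions rest. -/
theorem chunks_eq_cons {c : ℕ} (hc : 0 < c) {L : List α} (hL : L ≠ []) :
    chunks c L = L.take c :: chunks c (L.drop c) := by
  have hpos : 0 < L.length := List.length_pos_iff.2 hL
  have e : L.length ⌈/⌉ c = (L.drop c).length ⌈/⌉ c + 1 := by
    rw [List.length_drop, Nat.ceilDiv_eq_add_pred_div, Nat.ceilDiv_eq_add_pred_div]
    rcases le_total c L.length with h | h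
    · rw [← Nat.add_div_right _ hc]; congr 1; omega
    · rw [Nat.sub_eq_zero_of_le h, Nat.div_eq_of_lt (by omega : 0 + c - 1 < c)]
      exact Nat.div_eq_of_lt_le (by omega) (by omega)
  unfold chunks
  rw [e, List.range_succ_eq_map, List.map_cons, List.map_map]
  simp only [Nat.mul_zero, List.drop_zero, List.cons.injEq, true_and, List.drop_drop]
  refine List.map_congr_left fun k _ => ?_
  simp only [Function.comp, Nat.succ_eq_add_one]
  congr 2; ring

theorem chunks_induction {c : ℕ} (hc : 0 < c) {p : List α → Prop} (nil : p [])
    (step : ∀ L, L ≠ [] → p (L.drop c) → p L) (L : List α) : p L := by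
  induction hn : L.length using Nat.strong_induction_on generalizing L with
  | _ n ih =>
    rcases eq_or_ne L [] with rfl | hL
    · exact nil
    · have := List.length_pos_iff.2 hL
      exact step L hL (ih _ (by rw [List.length_drop]; omega) _ rfl)

theorem flatten_chunks {c : ℕ} (hc : 0 < c) (L : List α) : (chunks c L).flatten = L := by
  induction L using chunks_induction hc with
  | nil => simp
  | step L hL ih => rw [chunks_eq_cons hc hL, List.flatten_cons, ih, List.take_append_drop]

theorem mem_chunks {c : ℕ} (hc : 0 < c) {L F : List α} (hF : F ∈ chunks c L) :
    F ≠ [] ∧ F.length ≤ c := by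
  induction L using chunks_induction hc with
  | nil => simp at hF
  | step L hL ih =>
    rw [chunks_eq_cons hc hL] at hF
    rcases List.mem_cons.1 hF with rfl | hF
    · refine ⟨?_, List.length_take_le _ _⟩
      rw [Ne, List.take_eq_nil_iff]
      exact fun h => h.elim (fun h => by omega) hL
    · exact ih hF

/-- The value at the last element of a list. -/
def endValue (D : α → ℝ) (F : List α) : ℝ := F.getLast?.elim 0 D

theorem endValue_nonneg {D : α → ℝ} (hD : ∀ x, 0 ≤ D x) (F : List α) : 0 ≤ endValue D F := by
  unfold endValue
  cases F.getLast? with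
  | none => exact le_rfl
  | some x => exact hD x

@[simp] theorem endValue_concat (D : α → ℝ) (l : List α) (x : α) :
    endValue D (l ++ [x]) = D x := by
  simp [endValue]

theorem endValue_drop (D : α → ℝ) {L : List α} {k : ℕ} (hk : k < L.length) :
    endValue D (L.drop k) = endValue D L := by
  unfold endValue
  rw [List.getLast?_drop, if_neg (by omega)]

/-- The sum of the values at the positions `φ, φ + c, φ + 2 * c, …` of a list, counted from `1`. -/
def residueSum (D : α → ℝ) {c : ℕ} : ZMod c → List α → ℝ
  | _, [] => 0
  | φ, x :: l => (if φ = 1 then D x else 0) + residueSum D (φ - 1) l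

theorem residueSum_nonneg {D : α → ℝ} (hD : ∀ x, 0 ≤ D x) {c : ℕ} (φ : ZMod c) (L : List α) :
    0 ≤ residueSum D φ L := by
  induction L generalizing φ with
  | nil => exact le_rfl
  | cons x l ih =>
    refine add_nonneg ?_ (ih _)
    split_ifs
    · exact hD x
    · exact le_rfl

theorem residueSum_append (D : α → ℝ) {c : ℕ} (φ : ZMod c) (l₁ l₂ : List α) :
    residueSum D φ (l₁ ++ l₂) = residueSum D φ l₁ + residueSum D (φ - (l₁.length : ZMod c)) l₂ := by
  induction l₁ generalizing φ with
  | nil => simp [residueSum]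
  | cons x l ih =>
    simp only [List.cons_append, residueSum, ih, List.length_cons, Nat.cast_add, Nat.cast_one]
    rw [sub_sub φ, add_comm (1 : ZMod c), add_assoc]

/-- The last element stands at position `F.length`, so its own residue class counts it, and the
other terms are nonnegative. -/
theorem endValue_le_residueSum {D : α → ℝ} (hD : ∀ x, 0 ≤ D x) {c : ℕ} (F : List α) :
    endValue D F ≤ residueSum D (F.length : ZMod c) F := by
  rcases List.eq_nil_or_concat F with rfl | ⟨l, x, rfl⟩
  · simp [endValue, residueSum]
  · rw [List.concat_eq_append, endValue_concat, residueSum_append]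
    have := residueSum_nonneg hD ((l ++ [x]).length : ZMod c) l
    simp only [List.length_append, List.length_singleton, Nat.cast_add, Nat.cast_one,
      add_sub_cancel_left, residueSum, if_true, add_zero] at this ⊢
    linarith

/-- Every position lies in exactly one residue class. In the induction, dropping the head shifts the
classes by a bijection of `ZMod c`. -/
theorem sum_residueSum (D : α → ℝ) {c : ℕ} [NeZero c] (L : List α) :
    ∑ φ : ZMod c, residueSum D φ L = (L.map D).sum := by
  induction L with
  | nil => simp [residueSum]
  | cons x l ih =>
    simp only [residueSum, Finset.sum_add_distrib, Finset.sum_ite_eq', Finset.mem_univ, if_true,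
      List.map_cons, List.sum_cons]
    rw [← ih, ← Equiv.sum_comp (Equiv.subRight (1 : ZMod c)) fun φ => residueSum D φ l]
    rfl

/-- All pieces but the last end at multiples of `c`, hence in class `0`; the last one ends where `L`
ends. -/
theorem sum_endValue_chunks_le {D : α → ℝ} (hD : ∀ x, 0 ≤ D x) {c : ℕ} (hc : 0 < c) (L : List α) :
    ((chunks c L).map (endValue D)).sum ≤ residueSum D (0 : ZMod c) L + endValue D L := by
  induction L using chunks_induction hc with
  | nil => simp [residueSum, endValue]
  | step L hL ih =>
    rw [chunks_eq_cons hc hL, List.map_cons, List.sum_cons]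
    rcases le_or_gt L.length c with h | h
    · rw [List.drop_eq_nil_of_le h, List.take_of_length_le h]
      have := residueSum_nonneg hD (0 : ZMod c) L
      simp only [chunks_nil, List.map_nil, List.sum_nil]
      linarith
    · rw [endValue_drop D h] at ih
      have h1 := endValue_le_residueSum hD (c := c) (L.take c)
      have h2 := residueSum_append D (0 : ZMod c) (L.take c) (L.drop c)
      rw [List.length_take, min_eq_left h.le, ZMod.natCast_self] at h1
      rw [List.take_append_drop, List.length_take, min_eq_left h.le, ZMod.natCast_self,
        sub_zero] at h2
      linarith

/-- The fragments end at `θ, θ + c, θ + 2 * c, …`, all in the class of `θ`, except possibly the last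
one. Since `θ < L.length`, something remains behind the first fragment, and its end is the end of
`L`. -/
theorem sum_endValue_fragments_le {D : α → ℝ} (hD : ∀ x, 0 ≤ D x) {c θ : ℕ} (hc : 0 < c)
    {L : List α} (hθ : θ < L.length) :
    ((fragments c θ L).map (endValue D)).sum ≤ residueSum D (θ : ZMod c) L + endValue D L := by
  rw [fragments_eq, List.map_cons, List.sum_cons]
  have h0 := sum_endValue_chunks_le hD hc (L.drop θ)
  rw [endValue_drop D hθ] at h0
  have h1 := endValue_le_residueSum hD (c := c) (L.take θ)
  have h2 := residueSum_append D (θ : ZMod c) (L.take θ) (L.drop θ)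
  rw [List.length_take, min_eq_left hθ.le] at h1
  rw [List.take_append_drop, List.length_take, min_eq_left hθ.le, sub_self] at h2
  linarith

end Fragments

variable (I : Instance)

/-- The fragments in which a vehicle serves the requests of its tour. -/
def algFragments (T : I.Tours) (θ : Fin I.h → ℕ) (i : Fin I.h) : List (List (Fin I.m)) :=
  if (T i).length ≤ I.cap then [T i] else fragments I.cap (θ i) (T i)

theorem algRoutes_eq (T : I.Tours) (θ : Fin I.h → ℕ) (i : Fin I.h) :
    I.algRoutes T θ i = (I.algFragments T θ i).flatMap I.serve := by
  unfold algRoutes algFragments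
  split_ifs <;> simp

theorem flatten_algFragments (T : I.Tours) (θ : Fin I.h → ℕ) (i : Fin I.h) :
    (I.algFragments T θ i).flatten = T i := by
  unfold algFragments
  split_ifs
  · simp
  · rw [fragments_eq, List.flatten_cons, flatten_chunks I.cap_pos, List.take_append_drop]

theorem length_le_of_mem_algFragments {T : I.Tours} {θ : Fin I.h → ℕ} {i : Fin I.h}
    (hθ : θ i ≤ I.cap) {F : List (Fin I.m)} (hF : F ∈ I.algFragments T θ i) :
    F.length ≤ I.cap := by
  unfold algFragments at hF
  split_ifs at hF with h
  · rwa [List.mem_singleton.1 hF]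
  · rw [fragments_eq] at hF
    rcases List.mem_cons.1 hF with rfl | hF
    · exact (List.length_take_le _ _).trans hθ
    · exact (mem_chunks I.cap_pos hF).2

theorem ne_nil_of_mem_algFragments {T : I.Tours} {θ : Fin I.h → ℕ} {i : Fin I.h}
    (hθ : 1 ≤ θ i) (hT : T i ≠ []) {F : List (Fin I.m)} (hF : F ∈ I.algFragments T θ i) :
    F ≠ [] := by
  unfold algFragments at hF
  split_ifs at hF with h
  · rwa [List.mem_singleton.1 hF]
  · rw [fragments_eq] at hF
    rcases List.mem_cons.1 hF with rfl | hF
    · rw [Ne, List.take_eq_nil_iff]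
      exact fun h => h.elim (fun h => by omega) hT
    · exact (mem_chunks I.cap_pos hF).1

/-! ### Feasibility of the routes -/

theorem count_pickup_serve (B : List (Fin I.m)) (j : Fin I.m) :
    (I.serve B).count (.pickup j) = B.count j := by
  have h1 : (B.map Stop.pickup).count (Stop.pickup (n := I.n) j) = B.count j :=
    List.count_map_of_injective _ _ (fun a b h => by cases h; rfl) _
  have h2 : (B.map Stop.deliver).count (Stop.pickup (n := I.n) j) = 0 :=
    List.count_eq_zero.2 (by simp)
  rw [serve, List.count_append, h1, h2, Nat.add_zero]

theorem count_deliver_serve (B : List (Fin I.m)) (j : Fin I.m) :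
    (I.serve B).count (.deliver j) = B.count j := by
  have h1 : (B.map Stop.deliver).count (Stop.deliver (n := I.n) j) = B.count j :=
    List.count_map_of_injective _ _ (fun a b h => by cases h; rfl) _
  have h2 : (B.map Stop.pickup).count (Stop.deliver (n := I.n) j) = 0 :=
    List.count_eq_zero.2 (by simp)
  rw [serve, List.count_append, h1, h2, Nat.zero_add]

theorem count_pickup_flatMap_serve (Fs : List (List (Fin I.m))) (j : Fin I.m) :
    (Fs.flatMap I.serve).count (.pickup j) = Fs.flatten.count j := by
  induction Fs with
  | nil => simp
  | cons F Fs ih =>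
    rw [List.flatMap_cons, List.flatten_cons, List.count_append, List.count_append, ih,
      count_pickup_serve]

theorem count_deliver_flatMap_serve (Fs : List (List (Fin I.m))) (j : Fin I.m) :
    (Fs.flatMap I.serve).count (.deliver j) = Fs.flatten.count j := by
  induction Fs with
  | nil => simp
  | cons F Fs ih =>
    rw [List.flatMap_cons, List.flatten_cons, List.count_append, List.count_append, ih,
      count_deliver_serve]

theorem isPrefix_append_cases {α : Type*} {p a b : List α} (h : p <+: a ++ b) :
    p <+: a ∨ ∃ q, p = a ++ q ∧ q <+: b := by
  obtain ⟨r, hr⟩ := h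
  rcases List.append_eq_append_iff.1 hr with ⟨q, h1, -⟩ | ⟨q, h1, h2⟩
  · exact Or.inl ⟨q, h1.symm⟩
  · exact Or.inr ⟨q, h1, ⟨r, h2.symm⟩⟩

/-- A prefix either stays among the pickups, and then has no delivery, or contains all pickups of
the fragment. -/
theorem count_deliver_le_of_isPrefix_serve (B : List (Fin I.m)) {p : List (Stop I.n I.m)}
    (hp : p <+: I.serve B) (j : Fin I.m) : p.count (.deliver j) ≤ p.count (.pickup j) := by
  rcases isPrefix_append_cases hp with h | ⟨q, rfl, h⟩
  · rw [List.count_eq_zero.2 fun hm => by simpa using h.subset hm]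
    exact Nat.zero_le _
  · have h0 := count_deliver_serve I B j
    have h1 := count_pickup_serve I B j
    have h2 := h.sublist.count_le (.deliver j)
    have h3 : (B.map Stop.deliver).count (Stop.pickup (n := I.n) j) = 0 :=
      List.count_eq_zero.2 (by simp)
    rw [serve, List.count_append] at h0 h1
    rw [List.count_append, List.count_append]
    omega

theorem count_deliver_le_of_isPrefix (Fs : List (List (Fin I.m))) {p : List (Stop I.n I.m)}
    (hp : p <+: Fs.flatMap I.serve) (j : Fin I.m) : p.count (.deliver j) ≤ p.count (.pickup j) := by
  induction Fs generalizing p with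
  | nil => rw [List.prefix_nil.1 hp]; simp
  | cons F Fs ih =>
    rw [List.flatMap_cons] at hp
    rcases isPrefix_append_cases hp with h | ⟨q, rfl, h⟩
    · exact I.count_deliver_le_of_isPrefix_serve F h j
    · have := ih h
      rw [List.count_append, List.count_append, count_pickup_serve, count_deliver_serve]
      omega

theorem countP_serve (B : List (Fin I.m)) :
    (I.serve B).countP Stop.isPickup = B.length ∧ (I.serve B).countP Stop.isDelivery = B.length := by
  unfold serve
  constructor <;> rw [List.countP_append, List.countP_map, List.countP_map] <;>
    simp [Function.comp_def, Stop.isPickup, Stop.isDelivery]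

/-- The vehicle is empty between fragments, so the load never exceeds the size of the current
fragment. -/
theorem countP_isPickup_le_of_isPrefix (Fs : List (List (Fin I.m)))
    (hF : ∀ F ∈ Fs, F.length ≤ I.cap) {p : List (Stop I.n I.m)} (hp : p <+: Fs.flatMap I.serve) :
    p.countP Stop.isPickup ≤ p.countP Stop.isDelivery + I.cap := by
  induction Fs generalizing p with
  | nil => rw [List.prefix_nil.1 hp]; simp
  | cons F Fs ih =>
    rw [List.flatMap_cons] at hp
    rcases isPrefix_append_cases hp with h | ⟨q, rfl, h⟩
    · have h1 := h.sublist.countP_le (p := Stop.isPickup)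
      rw [(I.countP_serve F).1] at h1
      exact (h1.trans (hF F (by simp))).trans (Nat.le_add_left _ _)
    · have := ih (fun F hF' => hF F (List.mem_cons_of_mem _ hF')) h
      rw [List.countP_append, List.countP_append, (I.countP_serve F).1, (I.countP_serve F).2]
      omega

theorem isFeasible_algRoutes {T : I.Tours} (hT : I.IsMTSP T) {θ : Fin I.h → ℕ}
    (hθ : ∀ i, θ i ≤ I.cap) : I.IsFeasible (I.algRoutes T θ) where
  pickup_once j := by
    simp only [algRoutes_eq, count_pickup_flatMap_serve, flatten_algFragments]
    exact hT j
  same_vehicle i j := by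
    rw [algRoutes_eq, count_pickup_flatMap_serve, count_deliver_flatMap_serve]
  order i j p hp := by
    rw [algRoutes_eq] at hp
    exact I.count_deliver_le_of_isPrefix _ hp j
  capacity i p hp := by
    rw [algRoutes_eq] at hp
    exact I.countP_isPickup_le_of_isPrefix _
      (fun F hF => I.length_le_of_mem_algFragments (hθ i) hF) hp

/-! ### The weight of the routes -/

/-- The distance over which the item of a request has to be carried. -/
def haul (j : Fin I.m) : ℝ := I.w (I.src j) (I.dst j)

theorem haul_nonneg (j : Fin I.m) : 0 ≤ I.haul j := I.w_nonneg _ _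

theorem walkWeight_wH_inr (L : List (Fin I.m)) :
    walkWeight I.wH (L.map Sum.inr) =
      walkWeight I.w (L.map I.src) + walkWeight I.w (L.map I.dst) := by
  rw [walkWeight_map, walkWeight_map, walkWeight_map, ← walkWeight_add]
  rfl

theorem map_loc_serve (B : List (Fin I.m)) :
    (I.serve B).map I.loc = B.map I.src ++ B.map I.dst := by
  simp [serve, Function.comp_def, loc]

/-- From the source of the last request the vehicle may go to its destination, one haul, and back
along the destinations to the first one. So the destinations are traversed at most twice. -/
theorem walkWeight_serve_le (B : List (Fin I.m)) :
    walkWeight I.w ((I.serve B).map I.loc) ≤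
      2 * walkWeight I.wH (B.map Sum.inr) + endValue I.haul B := by
  rw [map_loc_serve, walkWeight_wH_inr]
  rcases List.eq_nil_or_concat B with rfl | ⟨l, b, rfl⟩
  · simp [endValue]
  rw [List.concat_eq_append, endValue_concat]
  have hs := walkWeight_nonneg I.w_nonneg ((l ++ [b]).map I.src)
  have hd := walkWeight_nonneg I.w_nonneg ((l ++ [b]).map I.dst)
  rcases l with _ | ⟨a, l⟩
  · simp [haul]
  · have e := walkWeight_concat_append_cons I.w (I.src a :: l.map I.src) (I.src b) (I.dst a)
      (l.map I.dst ++ [I.dst b])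
    have h1 := dist_le_walkWeight I.w_triangle (l.map I.dst) (I.dst a) (I.dst b)
    have h2 := I.w_triangle (I.src b) (I.dst b) (I.dst a)
    have h3 := I.w_symm (I.dst b) (I.dst a)
    simp only [List.cons_append, List.map_cons, List.map_append, List.map_nil, haul] at *
    linarith

/-- To pass from the destination of the last request `b` of a fragment to the next fragment, return
to the source of `b`, a second haul, and use the tour edge. The final fragment needs no return;
counting its haul twice is harmless. -/
theorem walkWeight_flatMap_serve_le (Fs : List (List (Fin I.m))) (hF : ∀ F ∈ Fs, F ≠ []) :
    walkWeight I.w ((Fs.flatMap I.serve).map I.loc) ≤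
      2 * walkWeight I.wH (Fs.flatten.map Sum.inr) + 2 * (Fs.map (endValue I.haul)).sum := by
  induction Fs with
  | nil => simp
  | cons F Fs ih =>
    have h0 := I.walkWeight_serve_le F
    have hend := endValue_nonneg I.haul_nonneg F
    rcases Fs with _ | ⟨G, Fs⟩
    · simp only [List.flatMap_cons, List.flatMap_nil, List.append_nil, List.flatten_cons,
        List.flatten_nil, List.map_cons, List.map_nil, List.sum_cons, List.sum_nil]
      linarith
    have ih' := ih fun F hF' => hF F (List.mem_cons_of_mem _ hF')
    rw [List.flatMap_cons, List.flatten_cons, List.map_cons, List.sum_cons, List.map_append,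
      List.map_append]
    rcases List.eq_nil_or_concat F with hnil | ⟨l, b, rfl⟩
    · exact absurd hnil (hF F (by simp))
    rcases G with _ | ⟨c, G⟩
    · exact absurd rfl (hF [] (by simp))
    rw [List.concat_eq_append] at *
    obtain ⟨X, hX⟩ : ∃ X, (I.serve (l ++ [b])).map I.loc = X ++ [I.dst b] :=
      ⟨(l ++ [b]).map I.src ++ l.map I.dst, by rw [map_loc_serve]; simp⟩
    obtain ⟨Y, hY⟩ : ∃ Y, (((c :: G) :: Fs).flatMap I.serve).map I.loc = I.src c :: Y :=
      ⟨_, by rw [List.flatMap_cons, List.map_append, map_loc_serve]; rfl⟩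
    have e₁ := walkWeight_concat_append_cons I.w X (I.dst b) (I.src c) Y
    have e₂ := walkWeight_concat_append_cons I.wH (l.map Sum.inr) (Sum.inr b) (Sum.inr c)
      ((G ++ Fs.flatten).map Sum.inr)
    have h2 := I.w_triangle (I.dst b) (I.src b) (I.src c)
    have h3 := I.w_symm (I.dst b) (I.src b)
    have h4 := I.w_nonneg (I.dst b) (I.dst c)
    have h5 := I.w_nonneg (I.src b) (I.src c)
    rw [endValue_concat] at h0 ⊢
    rw [hX] at h0 ⊢
    rw [hY] at ih' ⊢
    simp only [wH, List.flatten_cons, List.cons_append, List.map_cons, List.map_append,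
      List.map_nil, haul] at *
    linarith

/-- The last request `b` of the tour ends a fragment for every offset, so averaging cannot help. But
its haul, via the depot, is at most the weight in `H` of the closing edge from `b`, which the tour
pays for. -/
theorem routeWeight_flatMap_serve_le (i : Fin I.h) {L : List (Fin I.m)} (hL : L ≠ [])
    (Fs : List (List (Fin I.m))) (hF : ∀ F ∈ Fs, F ≠ []) (hFL : Fs.flatten = L) {r : ℝ}
    (hr : (Fs.map (endValue I.haul)).sum ≤ r + endValue I.haul L) :
    I.routeWeight i (Fs.flatMap I.serve) ≤
      2 * tourWeight I.wH (Sum.inl i :: L.map Sum.inr) + 2 * r := by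
  have h0 := I.walkWeight_flatMap_serve_le Fs hF
  obtain ⟨a, Y, hY, l, hl⟩ : ∃ a Y, (Fs.flatMap I.serve).map I.loc = I.src a :: Y ∧
      ∃ l, L = a :: l := by
    rcases Fs with _ | ⟨F, Fs⟩
    · exact absurd hFL.symm hL
    rcases F with _ | ⟨a, F⟩
    · exact absurd rfl (hF [] (by simp))
    · exact ⟨a, _, by rw [List.flatMap_cons, List.map_append, map_loc_serve]; rfl, _, hFL.symm⟩
  obtain ⟨l', b, hb⟩ : ∃ l' b, L = l' ++ [b] := by
    rcases List.eq_nil_or_concat L with h | ⟨l', b, h⟩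
    · exact absurd h hL
    · exact ⟨l', b, by rw [h, List.concat_eq_append]⟩
  have hend : endValue I.haul L = I.haul b := by rw [hb, endValue_concat]
  have htri := I.w_triangle (I.src b) (I.depot i) (I.dst b)
  have hsym := I.w_symm (I.src b) (I.depot i)
  have htour : tourWeight I.wH (Sum.inl i :: L.map Sum.inr) =
      I.wH (Sum.inl i) (Sum.inr a) + walkWeight I.wH (L.map Sum.inr) +
        I.wH (Sum.inr b) (Sum.inl i) := by
    have e := walkWeight_concat_append_cons I.wH (l'.map Sum.inr) (Sum.inr b) (Sum.inl i) []
    have e' : l'.map Sum.inr ++ [Sum.inr b] = (L.map Sum.inr : List (Fin I.h ⊕ Fin I.m)) := by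
      rw [hb]; simp
    rw [e'] at e
    simp only [tourWeight]
    rw [hl] at e ⊢
    simp only [List.map_cons, List.cons_append, walkWeight_cons_cons, walkWeight_singleton] at e ⊢
    linarith
  have hd := I.w_nonneg (I.depot i) (I.dst a)
  have hs := I.w_nonneg (I.depot i) (I.src a)
  rw [hFL] at h0
  rw [htour, routeWeight, hY, walkWeight_cons_cons]
  rw [hY] at h0
  simp only [wH, haul] at *
  linarith

theorem routeWeight_algRoutes_le (T : I.Tours) (θ : Fin I.h → ℕ) (i : Fin I.h) (hθ : 1 ≤ θ i)
    (hθ' : θ i ≤ I.cap) :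
    I.routeWeight i (I.algRoutes T θ i) ≤ 2 * tourWeight I.wH (Sum.inl i :: (T i).map Sum.inr) +
      2 * residueSum I.haul (θ i : ZMod I.cap) (T i) := by
  rcases eq_or_ne (T i) [] with hT | hT
  · rw [algRoutes, hT]
    simp [serve, routeWeight, residueSum, tourWeight, wH, I.w_self]
  · rw [algRoutes_eq]
    refine I.routeWeight_flatMap_serve_le i hT _
      (fun F hF => I.ne_nil_of_mem_algFragments hθ hT hF) (I.flatten_algFragments T θ i) ?_
    unfold algFragments
    split_ifs with h
    · have := residueSum_nonneg I.haul_nonneg (θ i : ZMod I.cap) (T i)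
      simpa using this
    · exact sum_endValue_fragments_le I.haul_nonneg I.cap_pos (by omega)

/-- A coordinate of a uniformly distributed vector is uniformly distributed. -/
theorem expect_comp_apply {ι κ : Type*} [Fintype ι] [DecidableEq ι] [Fintype κ] [Nonempty κ]
    (i : ι) (F : κ → ℝ) : (𝔼 θ : ι → κ, F (θ i)) = 𝔼 k, F k := by
  rw [Fintype.expect_equiv (Equiv.funSplitAt i κ) (fun θ => F (θ i)) (fun q => F q.1) fun _ => rfl]
  rw [← Finset.univ_product_univ, Finset.expect_product]
  simp only [Fintype.expect_const]

/-- The offsets `1, …, c` represent each residue class exactly once. -/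
theorem sum_residueSum_natCast {α : Type*} (D : α → ℝ) {c : ℕ} (hc : 0 < c) (L : List α) :
    ∑ k : Fin c, residueSum D (((k : ℕ) + 1 : ℕ) : ZMod c) L = (L.map D).sum := by
  obtain ⟨n, rfl⟩ : ∃ n, c = n + 1 := ⟨c - 1, by omega⟩
  rw [← sum_residueSum (c := n + 1),
    ← Equiv.sum_comp (Equiv.addRight (1 : ZMod (n + 1))) fun φ => residueSum D φ L]
  refine Finset.sum_congr rfl fun k _ => ?_
  congr 1
  rw [Nat.cast_add, Nat.cast_one]
  congr 1
  exact Fin.cast_val_eq_self k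

theorem sum_map_eq_sum_count_mul (D : Fin I.m → ℝ) (L : List (Fin I.m)) :
    (L.map D).sum = ∑ j, (L.count j : ℝ) * D j := by
  induction L with
  | nil => simp
  | cons a l ih =>
    simp only [List.map_cons, List.sum_cons, List.count_cons, Nat.cast_add, add_mul,
      Finset.sum_add_distrib, ih]
    simp [add_comm]

/-- Averaging over the offset turns the sum over one residue class into `1 / cap` of the sum over
the tour, and every request lies on exactly one tour. -/
theorem algExpectedWeight_le {T : I.Tours} (hT : I.IsMTSP T) :
    I.algExpectedWeight T ≤ 2 * I.mtspWeight T + 2 * ((∑ j, I.haul j) / I.cap) := by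
  have : Nonempty (Fin I.cap) := ⟨⟨0, I.cap_pos⟩⟩
  have h1 : I.algExpectedWeight T ≤ 𝔼 θ : Fin I.h → Fin I.cap,
      ∑ i, (2 * tourWeight I.wH (Sum.inl i :: (T i).map Sum.inr) +
        2 * residueSum I.haul (((θ i : ℕ) + 1 : ℕ) : ZMod I.cap) (T i)) := by
    refine Finset.expect_le_expect fun θ _ => ?_
    rw [weight_eq]
    exact Finset.sum_le_sum fun i _ => I.routeWeight_algRoutes_le T _ i (by omega)
      (by have := (θ i).2; omega)
  refine h1.trans (le_of_eq ?_)
  rw [Finset.expect_sum_comm]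
  have h2 : ∀ i, (𝔼 θ : Fin I.h → Fin I.cap,
      (2 * tourWeight I.wH (Sum.inl i :: (T i).map Sum.inr) +
        2 * residueSum I.haul (((θ i : ℕ) + 1 : ℕ) : ZMod I.cap) (T i))) =
      2 * tourWeight I.wH (Sum.inl i :: (T i).map Sum.inr) +
        2 * (∑ j, ((T i).count j : ℝ) * I.haul j / I.cap) := by
    intro i
    rw [expect_comp_apply i fun k : Fin I.cap =>
      2 * tourWeight I.wH (Sum.inl i :: (T i).map Sum.inr) +
        2 * residueSum I.haul (((k : ℕ) + 1 : ℕ) : ZMod I.cap) (T i),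
      Finset.expect_add_distrib, Fintype.expect_const, ← Finset.mul_expect,
      Fintype.expect_eq_sum_div_card, sum_residueSum_natCast _ I.cap_pos, Fintype.card_fin,
      sum_map_eq_sum_count_mul, Finset.sum_div]
  simp only [h2]
  rw [Finset.sum_add_distrib, ← Finset.mul_sum, ← Finset.mul_sum, Finset.sum_comm, Finset.sum_div]
  congr 2
  refine Finset.sum_congr rfl fun j _ => ?_
  rw [← Finset.sum_div, ← Finset.sum_mul]
  have := hT j
  rw [← Nat.cast_sum, this, Nat.cast_one, one_mul]

/-- The approximation guarantee. -/
theorem algExpectedWeight_le_opt {T : I.Tours} (hT : I.IsTwoApproxMTSP T) :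
    I.algExpectedWeight T ≤ 200 * (Real.sqrt I.cap * Real.log (I.m + 1)) * I.opt := by
  have hfeas : I.IsFeasible (I.algRoutes T fun _ => I.cap) :=
    I.isFeasible_algRoutes hT.1 fun _ => le_rfl
  have hlog0 : 0 ≤ Real.log (I.m + 1) := Real.log_nonneg (by simp)
  set K : ℝ := 200 * (Real.sqrt I.cap * Real.log (I.m + 1)) with hK
  have hK0 : 0 ≤ K := by positivity
  -- Passing to the infimum divides by `K`. If `K = 0`, a single feasible solution already gives the
  -- claim.
  suffices h : ∀ R, I.IsFeasible R → I.algExpectedWeight T ≤ K * I.weight R by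
    rcases hK0.eq_or_lt with h0 | h0
    · have := h _ hfeas
      rw [← h0] at this ⊢
      simpa using this
    · rw [← div_le_iff₀' h0]
      refine le_csInf ⟨_, _, hfeas, rfl⟩ ?_
      rintro _ ⟨R, hR, rfl⟩
      rw [div_le_iff₀' h0]
      exact h R hR
  intro R hR
  have hcap : (0 : ℝ) < I.cap := by exact_mod_cast I.cap_pos
  have hW : 0 ≤ I.weight R := by
    rw [weight_eq]; exact Finset.sum_nonneg fun i _ => I.routeWeight_nonneg i _
  have h1 := I.algExpectedWeight_le hT.1
  -- Without requests the logarithm is `0`, so the expected weight itself must be at most `0`: all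
  -- tours are empty.
  rcases Nat.eq_zero_or_pos I.m with hm | hm
  · have hlog : Real.log ((I.m : ℝ) + 1) = 0 := by rw [hm]; simp
    have : IsEmpty (Fin I.m) := by rw [hm]; infer_instance
    have hnil : ∀ i, T i = [] := fun i => List.eq_nil_iff_forall_not_mem.2 fun a => isEmptyElim a
    have : I.mtspWeight T = 0 := by
      unfold mtspWeight
      simp [hnil, tourWeight, wH, I.w_self]
    rw [this] at h1
    rw [hK, hlog]
    simpa using h1
  set s := Real.sqrt I.cap with hs
  have hs1 : 1 ≤ s := Real.one_le_sqrt.2 (by exact_mod_cast I.cap_pos)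
  -- The `+ 1` gives `cap ≤ k * k`, at the price of `k ≤ 2 * s`, as `s ≥ 1`.
  set k := Nat.sqrt I.cap + 1 with hk
  have hkcap : I.cap ≤ k * k := (Nat.lt_succ_sqrt _).le
  have hks : (k : ℝ) ≤ 2 * s := by
    have : (Nat.sqrt I.cap : ℝ) ≤ s := Real.nat_sqrt_le_real_sqrt
    rw [hk]; push_cast; linarith
  set n := Nat.log 2 I.m + 1 with hn
  have hmn : I.m < 2 ^ n := Nat.lt_pow_succ_log_self one_lt_two _
  set ℓ := Real.log (I.m + 1) with hℓ
  have hℓ2 : Real.log 2 ≤ ℓ := Real.log_le_log two_pos (by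
    have : (1 : ℝ) ≤ I.m := by exact_mod_cast hm
    linarith)
  have hlog2 := Real.log_two_gt_d9
  have hnℓ : (n : ℝ) ≤ 3 * ℓ := by
    have h2 : ((Nat.log 2 I.m : ℕ) : ℝ) * Real.log 2 ≤ ℓ := by
      rw [← Real.log_pow]
      refine Real.log_le_log (by positivity) ?_
      have : (2 : ℝ) ^ Nat.log 2 I.m ≤ I.m := by exact_mod_cast Nat.pow_log_le_self 2 hm.ne'
      linarith
    rw [hn]; push_cast
    nlinarith [(Nat.cast_nonneg (Nat.log 2 I.m) : (0 : ℝ) ≤ _)]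
  obtain ⟨S, hS, hSw⟩ := hR.exists_isMTSP hkcap hmn
  have h2 := hT.2 S hS
  have h3 : (∑ j, I.haul j) / I.cap ≤ I.weight R := by
    rw [div_le_iff₀' hcap]; exact hR.sum_w_le
  have hsℓ : ℓ ≤ s * ℓ := le_mul_of_one_le_left hlog0 hs1
  -- `4 * k + 4 ≤ 12 * s` and `n ≤ 3 * ℓ` give `36`; the summand `4` is at most `6 * ℓ`, because
  -- `log 2 > 2 / 3`.
  have h4 : ((4 * k + 4) * n + 4 : ℝ) ≤ 42 * (s * ℓ) := by
    have : ((4 * k + 4) * n : ℝ) ≤ (12 * s) * (3 * ℓ) :=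
      mul_le_mul (by linarith) hnℓ (Nat.cast_nonneg _) (by linarith)
    nlinarith
  have h5 := mul_le_mul_of_nonneg_right h4 hW
  -- The total is `2 * 2 * 42 + 2 * 2 = 172`, below `200`: the tours count twice and are
  -- 2-approximate, the hauls contribute `2 * I.weight R`.
  have h6 : I.weight R ≤ 2 * (s * ℓ) * I.weight R :=
    le_mul_of_one_le_left hW (by linarith)
  rw [hK]
  linarith

end Instance

/-! ### Linked lists, cutting a path, inserting a vertex into a tour -/

instance lawfulBEqSum {α β : Type*} [BEq α] [BEq β] [LawfulBEq α] [LawfulBEq β] :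
    LawfulBEq (α ⊕ β) where
  eq_of_beq {a b} h := by
    rcases a with a | a <;> rcases b with b | b
    · exact congrArg Sum.inl (eq_of_beq (a := a) (b := b) h)
    · cases h
    · cases h
    · exact congrArg Sum.inr (eq_of_beq (a := a) (b := b) h)
  rfl {a} := by
    rcases a with a | a
    · exact beq_self_eq_true a
    · exact beq_self_eq_true a

section Linked

/-- The pointers `nx` chain the vertices of the list; the last pointer is `0`. -/
def Linked (nx : ℕ → ℕ) : List ℕ → Prop
  | [] => True
  | [x] => nx x = 0
  | x :: y :: l => nx x = y ∧ Linked nx (y :: l)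

theorem Linked.congr {nx nx' : ℕ → ℕ} {l : List ℕ} (h : ∀ x ∈ l, nx' x = nx x)
    (hl : Linked nx l) : Linked nx' l := by
  induction l with
  | nil => trivial
  | cons x l ih =>
    cases l with
    | nil => exact (h x (by simp)).trans hl
    | cons y l =>
      exact ⟨(h x (by simp)).trans hl.1, ih (fun z hz => h z (List.mem_cons_of_mem _ hz)) hl.2⟩

/-- Only the pointers of `p` and `q` change, and no other list element equals either of them. If `p`
was last, `q` inherits the end mark `0`. -/
theorem Linked.insert {nx : ℕ → ℕ} {p q : ℕ} {l₁ l₂ : List ℕ} (hl : Linked nx (l₁ ++ p :: l₂))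
    (hnd : (l₁ ++ p :: l₂).Nodup) (hq : q ∉ l₁ ++ p :: l₂) :
    Linked (Function.update (Function.update nx q (nx p)) p q) (l₁ ++ p :: q :: l₂) := by
  induction l₁ with
  | nil =>
    have hpq : q ≠ p := fun h => hq (by simp [h])
    refine ⟨by simp, ?_⟩
    cases l₂ with
    | nil => simpa [Linked, hpq] using hl
    | cons y l =>
      refine ⟨by simpa [hpq] using hl.1, hl.2.congr fun x hx => ?_⟩
      have hxp : x ≠ p := by
        rintro rfl
        exact (List.nodup_cons.1 hnd).1 hx
      have hxq : x ≠ q := by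
        rintro rfl
        exact hq (by simp at hx ⊢; tauto)
      simp [hxp, hxq]
  | cons a l ih =>
    rw [List.cons_append, List.nodup_cons] at hnd
    have hap : a ≠ p := by
      rintro rfl
      exact hnd.1 (by simp)
    have haq : a ≠ q := by
      rintro rfl
      exact hq (by simp)
    have hq' : q ∉ l ++ p :: l₂ := fun h => hq (by simp at h ⊢; tauto)
    cases l with
    | nil =>
      exact ⟨by simpa [hap, haq] using hl.1, ih hl.2 hnd.2 hq'⟩
    | cons b l =>
      exact ⟨by simpa [hap, haq] using hl.1, ih hl.2 hnd.2 hq'⟩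

end Linked

/-- A list that starts outside of `q` and meets `q` leaves the complement of `q` somewhere. -/
theorem exists_split_of_mem {α : Type*} (q : α → Prop) (y : α) (l : List α) (hy : ¬ q y)
    (h : ∃ x ∈ l, q x) :
    ∃ M a b M', y :: l = M ++ a :: b :: M' ∧ y ∈ M ++ [a] ∧ ¬ q a ∧ q b := by
  induction l generalizing y with
  | nil => simp at h
  | cons w l ih =>
    by_cases hw : q w
    · exact ⟨[], y, w, l, rfl, by simp, hy, hw⟩
    · obtain ⟨M, a, b, M', e, -, ha, hb⟩ := ih w hw <| by
        obtain ⟨x, hx, hqx⟩ := h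
        rcases List.mem_cons.1 hx with rfl | hx
        · exact absurd hqx hw
        · exact ⟨x, hx, hqx⟩
      exact ⟨y :: M, a, b, M', by rw [e]; rfl, by simp, ha, hb⟩

/-- On the way from `y` to `x` some edge enters `q`. The two alternatives are the two directions; in
both, deleting the edge leaves `y` in one piece and an end with `q` in the other. -/
theorem exists_split {α : Type*} (q : α → Prop) {l : List α} {x y : α} (hx : x ∈ l) (hqx : q x)
    (hy : y ∈ l) (hqy : ¬ q y) :
    ∃ M a b M', l = M ++ a :: b :: M' ∧
      (y ∈ M ++ [a] ∧ ¬ q a ∧ q b ∨ y ∈ b :: M' ∧ q a ∧ ¬ q b) := by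
  obtain ⟨l₁, l₂, rfl⟩ := List.append_of_mem hy
  have hx' : x ∈ l₁ ∨ x ∈ l₂ := by
    rcases List.mem_append.1 hx with h | h
    · exact Or.inl h
    · rcases List.mem_cons.1 h with rfl | h
      · exact absurd hqx hqy
      · exact Or.inr h
  rcases hx' with h | h
  · obtain ⟨M, a, b, M', e, hM, ha, hb⟩ := exists_split_of_mem q y l₁.reverse hqy
      ⟨x, List.mem_reverse.2 h, hqx⟩
    have e' := congrArg List.reverse e
    simp only [List.reverse_cons, List.reverse_reverse, List.reverse_append, List.append_assoc,
      List.cons_append] at e'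
    refine ⟨M'.reverse, b, a, M.reverse ++ l₂, ?_, Or.inr ⟨?_, hb, ha⟩⟩
    · have : l₁ ++ y :: l₂ = (l₁ ++ [y]) ++ l₂ := by simp
      rw [this, e']; simp
    · simp at hM ⊢; tauto
  · obtain ⟨M, a, b, M', e, hM, ha, hb⟩ := exists_split_of_mem q y l₂ hqy ⟨x, h, hqx⟩
    refine ⟨l₁ ++ M, a, b, M', by rw [e]; simp, Or.inl ⟨?_, ha, hb⟩⟩
    rw [List.append_assoc]
    exact List.mem_append_right _ hM

/-- If `y` follows `p` on the closed tour (possibly `y = o`), the detour `p q y` exceeds the edge `p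
y` by at most `2 * d p q`. -/
theorem tourWeight_insert_le {α : Type*} {d : α → α → ℝ} (hs : ∀ a b, d a b = d b a)
    (ht : ∀ a b c, d a c ≤ d a b + d b c) {o p q : α} {r r' l₁ l₂ : List α}
    (h : o :: r = l₁ ++ p :: l₂) (h' : o :: r' = l₁ ++ p :: q :: l₂) :
    tourWeight d (o :: r') ≤ tourWeight d (o :: r) + 2 * d p q := by
  obtain ⟨y, l, hy⟩ : ∃ y l, l₂ ++ [o] = y :: l := by
    cases l₂ with
    | nil => exact ⟨_, _, rfl⟩
    | cons y l => exact ⟨_, _, rfl⟩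
  have e : tourWeight d (o :: r) = walkWeight d (l₁ ++ p :: y :: l) := by
    rw [tourWeight, ← List.cons_append, h, ← hy]; simp
  have e' : tourWeight d (o :: r') = walkWeight d (l₁ ++ p :: q :: y :: l) := by
    rw [tourWeight, ← List.cons_append, h', ← hy]; simp
  rw [e, e', walkWeight_append_cons_cons, walkWeight_append_cons_cons, walkWeight_cons_cons]
  have := ht q p y
  have := hs q p
  linarith

namespace Instance

variable (I : Instance)

/-! ### The spanning forest and the tours -/

theorem wH_nonneg (a b) : 0 ≤ I.wH a b := by
  have := I.w_nonneg
  rcases a with a | a <;> rcases b with b | b <;> simp only [wH] <;>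
    first
    | exact mul_nonneg two_pos.le (this _ _)
    | exact add_nonneg (this _ _) (this _ _)

/-- A vertex of `H` is a pair of locations, twice the same for a depot, and `wH` is the sum metric.
Symmetry and the triangle inequality are inherited from `w`. -/
theorem wH_eq (a b) : I.wH a b =
    I.w (Sum.elim I.depot I.src a) (Sum.elim I.depot I.src b) +
      I.w (Sum.elim I.depot I.dst a) (Sum.elim I.depot I.dst b) := by
  rcases a with a | a <;> rcases b with b | b <;> simp only [wH, Sum.elim_inl, Sum.elim_inr]
  · ring
  · rw [I.w_symm _ (I.depot b), I.w_symm _ (I.depot b)]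

theorem wH_symm (a b) : I.wH a b = I.wH b a := by
  rw [wH_eq, wH_eq, I.w_symm, I.w_symm (Sum.elim I.depot I.dst a)]

theorem wH_triangle (a b c) : I.wH a c ≤ I.wH a b + I.wH b c := by
  rw [wH_eq, wH_eq, wH_eq]
  have h1 := I.w_triangle (Sum.elim I.depot I.src a) (Sum.elim I.depot I.src b)
    (Sum.elim I.depot I.src c)
  have h2 := I.w_triangle (Sum.elim I.depot I.dst a) (Sum.elim I.depot I.dst b)
    (Sum.elim I.depot I.dst c)
  linarith

/-- The vertices of `H` that belong to the forest: all depots and the requests in `A`. -/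
def InForest (A : Finset (Fin I.m)) : Fin I.h ⊕ Fin I.m → Prop :=
  Sum.elim (fun _ => True) (· ∈ A)

/-- The tour through depot `i` as a list of vertices of `H`. -/
def tourList (T : I.Tours) (i : Fin I.h) : List (Fin I.h ⊕ Fin I.m) :=
  Sum.inl i :: (T i).map Sum.inr

theorem count_tourList (T : I.Tours) (i : Fin I.h) (j : Fin I.m) :
    (I.tourList T i).count (Sum.inr j) = (T i).count j := by
  have := List.count_map_of_injective (T i) (Sum.inr : Fin I.m → Fin I.h ⊕ Fin I.m)
    Sum.inr_injective j
  simp [tourList, this]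

/-- `T` consists of tours through the depots and the requests in `A` whose weight is at most twice
`c`, and `c` is the weight of the part that has been constructed of a minimum spanning forest: with
the paths `Ps` one can connect the other requests at a cost that does not exceed what is left. -/
structure IsPartialSolution (A : Finset (Fin I.m)) (T : I.Tours) (c : ℝ) : Prop where
  count_eq : ∀ j, ∑ i, (T i).count j = if j ∈ A then 1 else 0
  weight_le : I.mtspWeight T ≤ 2 * c
  completion : ∀ S : I.Tours, I.IsMTSP S → ∃ Ps : List (List (Fin I.h ⊕ Fin I.m)),
    (∀ P ∈ Ps, ∃ v ∈ P, I.InForest A v) ∧ (∀ j, j ∉ A → ∃ P ∈ Ps, Sum.inr j ∈ P) ∧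
      c + (Ps.map (walkWeight I.wH)).sum ≤ I.mtspWeight S

theorem isPartialSolution_empty : I.IsPartialSolution ∅ (fun _ => []) 0 where
  count_eq j := by simp
  weight_le := by simp [mtspWeight, tourWeight, wH, I.w_self]
  completion S hS := by
    -- The initial paths are the tours of `S` without their closing edges; each contains its depot.
    refine ⟨(List.finRange I.h).map (I.tourList S), ?_, ?_, ?_⟩
    · intro P hP
      obtain ⟨i, -, rfl⟩ := List.mem_map.1 hP
      exact ⟨Sum.inl i, by simp [tourList], trivial⟩
    · intro j _
      obtain ⟨i, -, hi⟩ := Finset.exists_ne_zero_of_sum_ne_zero ((hS j).trans_ne one_ne_zero)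
      refine ⟨_, List.mem_map.2 ⟨i, List.mem_finRange i, rfl⟩, ?_⟩
      have := List.count_pos_iff.1 (Nat.pos_of_ne_zero hi)
      simpa [tourList] using this
    · rw [zero_add, List.map_map, ← Fin.sum_univ_def]
      refine Finset.sum_le_sum fun i _ => ?_
      exact walkWeight_le_of_isPrefix I.wH_nonneg ⟨[Sum.inl i], rfl⟩

variable {I} in
theorem IsPartialSolution.isTwoApproxMTSP {T : I.Tours} {c : ℝ}
    (h : I.IsPartialSolution Finset.univ T c) : I.IsTwoApproxMTSP T := by
  refine ⟨fun j => by simpa using h.count_eq j, fun S hS => ?_⟩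
  obtain ⟨Ps, -, -, hc⟩ := h.completion S hS
  have : 0 ≤ (Ps.map (walkWeight I.wH)).sum := List.sum_nonneg fun x hx => by
    obtain ⟨P, -, rfl⟩ := List.mem_map.1 hx
    exact walkWeight_nonneg I.wH_nonneg P
  have := h.weight_le
  linarith

variable {I} in
theorem InForest.mono {A B : Finset (Fin I.m)} (h : A ⊆ B) {v} (hv : I.InForest A v) :
    I.InForest B v := by
  rcases v with v | v
  · trivial
  · exact h hv

/-- A path through `j` also meets the forest, so between the two it crosses the border of the forest
on an edge of weight at least `δ`. Without this edge the path falls into two pieces: one contains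
`j`, now a forest vertex, the other an old forest vertex. -/
theorem exists_completion_insert {A : Finset (Fin I.m)} {j : Fin I.m} (hj : j ∉ A) {δ : ℝ}
    (hmin : ∀ u, I.InForest A u → ∀ j', j' ∉ A → δ ≤ I.wH u (Sum.inr j'))
    {Ps : List (List (Fin I.h ⊕ Fin I.m))} (h₁ : ∀ P ∈ Ps, ∃ v ∈ P, I.InForest A v)
    (h₂ : ∀ j, j ∉ A → ∃ P ∈ Ps, Sum.inr j ∈ P) :
    ∃ Qs : List (List (Fin I.h ⊕ Fin I.m)), (∀ P ∈ Qs, ∃ v ∈ P, I.InForest (insert j A) v) ∧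
      (∀ j', j' ∉ insert j A → ∃ P ∈ Qs, Sum.inr j' ∈ P) ∧
        δ + (Qs.map (walkWeight I.wH)).sum ≤ (Ps.map (walkWeight I.wH)).sum := by
  obtain ⟨P, hP, hjP⟩ := h₂ j hj
  obtain ⟨x, hxP, hx⟩ := h₁ P hP
  obtain ⟨Q₁, Q₂, rfl⟩ := List.append_of_mem hP
  obtain ⟨M, a, b, M', rfl, hM⟩ := exists_split (I.InForest A) hxP hx hjP hj
  have hsub : A ⊆ insert j A := Finset.subset_insert _ _
  have hjF : I.InForest (insert j A) (Sum.inr j) := Finset.mem_insert_self _ _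
  have hpieces : (∃ v ∈ M ++ [a], I.InForest (insert j A) v) ∧
      (∃ v ∈ b :: M', I.InForest (insert j A) v) ∧ δ ≤ I.wH a b := by
    rcases hM with ⟨hm, ha, hb⟩ | ⟨hm, ha, hb⟩
    · refine ⟨⟨_, hm, hjF⟩, ⟨b, by simp, InForest.mono hsub hb⟩, ?_⟩
      rcases a with a | a
      · exact absurd trivial ha
      · rw [I.wH_symm]; exact hmin b hb a ha
    · refine ⟨⟨a, by simp, InForest.mono hsub ha⟩, ⟨_, hm, hjF⟩, ?_⟩
      rcases b with b | b
      · exact absurd trivial hb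
      · exact hmin a ha b hb
  refine ⟨Q₁ ++ (M ++ [a]) :: (b :: M') :: Q₂, ?_, ?_, ?_⟩
  · intro P hP
    have hold : ∀ P, P ∈ Q₁ ∨ P ∈ Q₂ → ∃ v ∈ P, I.InForest (insert j A) v := fun P hP => by
      obtain ⟨v, hv, hvA⟩ := h₁ P (by
        rcases hP with h | h
        · exact List.mem_append_left _ h
        · exact List.mem_append_right _ (List.mem_cons_of_mem _ h))
      exact ⟨v, hv, InForest.mono hsub hvA⟩
    rcases List.mem_append.1 hP with h | h
    · exact hold P (Or.inl h)
    rcases List.mem_cons.1 h with rfl | h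
    · exact hpieces.1
    rcases List.mem_cons.1 h with rfl | h
    · exact hpieces.2.1
    · exact hold P (Or.inr h)
  · intro j' hj'
    obtain ⟨P, hP, hjP⟩ := h₂ j' fun h => hj' (hsub h)
    rcases List.mem_append.1 hP with h | h
    · exact ⟨P, List.mem_append_left _ h, hjP⟩
    rcases List.mem_cons.1 h with rfl | h
    · have hjP' : Sum.inr j' ∈ M ++ [a] ∨ Sum.inr j' ∈ b :: M' := by
        simp at hjP ⊢; tauto
      rcases hjP' with h' | h'
      · exact ⟨_, List.mem_append_right _ (by simp), h'⟩
      · exact ⟨_, List.mem_append_right _ (by simp), h'⟩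
    · exact ⟨P, List.mem_append_right _
        (List.mem_cons_of_mem _ (List.mem_cons_of_mem _ h)), hjP⟩
  · have e := walkWeight_append_cons_cons I.wH M a b M'
    have := hpieces.2.2
    simp only [List.map_append, List.map_cons, List.sum_append, List.sum_cons]
    linarith

theorem exists_insert_tours (A : Finset (Fin I.m)) {T : I.Tours}
    (hT : ∀ j, ∑ i, (T i).count j = if j ∈ A then 1 else 0) {p : Fin I.h ⊕ Fin I.m}
    (hp : I.InForest A p) (j : Fin I.m) :
    ∃ (T' : I.Tours) (i : Fin I.h) (l₁ l₂ : List (Fin I.h ⊕ Fin I.m)),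
      I.tourList T i = l₁ ++ p :: l₂ ∧ I.tourList T' i = l₁ ++ p :: Sum.inr j :: l₂ ∧
        ∀ i', i' ≠ i → T' i' = T i' := by
  rcases p with i | q
  · exact ⟨Function.update T i (j :: T i), i, [], _, rfl, by simp [tourList],
      fun i' hi' => Function.update_of_ne hi' _ _⟩
  · have h1 := hT q
    rw [if_pos (show q ∈ A from hp)] at h1
    obtain ⟨i, -, hi⟩ := Finset.exists_ne_zero_of_sum_ne_zero (h1.trans_ne one_ne_zero)
    obtain ⟨l₁, l₂, hl⟩ := List.append_of_mem (List.count_pos_iff.1 (Nat.pos_of_ne_zero hi))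
    refine ⟨Function.update T i (l₁ ++ q :: j :: l₂), i, Sum.inl i :: l₁.map Sum.inr,
      l₂.map Sum.inr, by simp [tourList, hl], by simp [tourList],
      fun i' hi' => Function.update_of_ne hi' _ _⟩

/-- The number under which the program knows a vertex of `H`. -/
def vertexId : Fin I.h ⊕ Fin I.m → ℕ := Sum.elim (fun i => i) fun j => I.h + j

theorem vertexId_injective : Function.Injective I.vertexId := by
  rintro (a | a) (b | b) h <;> simp only [vertexId, Sum.elim_inl, Sum.elim_inr] at h
  · rw [Fin.ext h]
  · have := a.2; omega
  · have := b.2; omega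
  · rw [Fin.ext (Nat.add_left_cancel h)]

/-- The pointers `nx` chain the vertices of every tour. -/
def IsLinked (nx : ℕ → ℕ) (T : I.Tours) : Prop :=
  ∀ i, Linked nx ((I.tourList T i).map I.vertexId)

theorem isLinked_empty : I.IsLinked (fun _ => 0) fun _ => [] := fun _ => rfl

theorem count_tourList_le (A : Finset (Fin I.m)) {T : I.Tours}
    (hT : ∀ j, ∑ i, (T i).count j = if j ∈ A then 1 else 0) (i : Fin I.h) (v) :
    (I.tourList T i).count v ≤ 1 := by
  rcases v with i' | j
  · unfold tourList
    rw [List.count_cons, List.count_eq_zero.2 (by simp), Nat.zero_add]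
    split_ifs <;> simp
  · rw [count_tourList]
    refine (Finset.single_le_sum (f := fun i => (T i).count j) (fun _ _ => Nat.zero_le _)
      (Finset.mem_univ i)).trans ?_
    rw [hT]
    split_ifs <;> simp

theorem tourList_disjoint (A : Finset (Fin I.m)) {T : I.Tours}
    (hT : ∀ j, ∑ i, (T i).count j = if j ∈ A then 1 else 0) {i i' : Fin I.h} (hne : i' ≠ i) {v}
    (hv : v ∈ I.tourList T i) : v ∉ I.tourList T i' := by
  intro hv'
  rcases v with k | j
  · simp only [tourList, List.mem_cons, Sum.inl.injEq, List.mem_map, reduceCtorEq, and_false,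
      exists_false, or_false] at hv hv'
    exact hne (hv'.symm.trans hv)
  · rw [← List.count_pos_iff, count_tourList] at hv hv'
    have h := hT j
    rw [← Finset.add_sum_erase _ _ (Finset.mem_univ i)] at h
    have h2 := Finset.single_le_sum (f := fun i => (T i).count j) (fun _ _ => Nat.zero_le _)
      (Finset.mem_erase.2 ⟨hne, Finset.mem_univ i'⟩)
    split_ifs at h <;> omega

variable {I} in
/-- Prim's algorithm takes the request `j` that is closest to the forest, with nearest vertex `p`, and
`j` is inserted behind `p` into the tour. -/
theorem IsPartialSolution.exists_insert {A : Finset (Fin I.m)} {T : I.Tours} {c : ℝ}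
    (hT : I.IsPartialSolution A T c) {nx : ℕ → ℕ} (hnx : I.IsLinked nx T) {j : Fin I.m} (hj : j ∉ A)
    {p : Fin I.h ⊕ Fin I.m} (hp : I.InForest A p)
    (hmin : ∀ u, I.InForest A u → ∀ j', j' ∉ A → I.wH p (Sum.inr j) ≤ I.wH u (Sum.inr j')) :
    ∃ T', I.IsPartialSolution (insert j A) T' (c + I.wH p (Sum.inr j)) ∧
      I.IsLinked (Function.update (Function.update nx (I.vertexId (Sum.inr j))
        (nx (I.vertexId p))) (I.vertexId p) (I.vertexId (Sum.inr j))) T' := by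
  obtain ⟨T', i, l₁, l₂, h, h', hne⟩ := I.exists_insert_tours A hT.count_eq hp j
  have hjmem : ∀ i, Sum.inr j ∉ I.tourList T i := fun i hm => by
    rw [← List.count_pos_iff, count_tourList] at hm
    have h0 := hT.count_eq j
    rw [if_neg hj] at h0
    exact hm.ne' (Finset.sum_eq_zero_iff.1 h0 i (Finset.mem_univ i))
  have hcount : ∀ j', (T' i).count j' = (T i).count j' + if j' = j then 1 else 0 := by
    intro j'
    rw [← count_tourList, ← count_tourList, h, h']
    simp only [List.count_append, List.count_cons, beq_iff_eq, Sum.inr.injEq, eq_comm (a := j)]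
    omega
  refine ⟨T', ⟨fun j' => ?_, ?_, fun S hS => ?_⟩, fun i' => ?_⟩
  · have hs : ∑ i', (T' i').count j' = ∑ i', (T i').count j' + if j' = j then 1 else 0 := by
      rw [← Finset.add_sum_erase _ _ (Finset.mem_univ i),
        ← Finset.add_sum_erase _ (fun i => (T i).count j') (Finset.mem_univ i), hcount,
        Finset.sum_congr rfl fun i' hi' => by rw [hne i' (Finset.ne_of_mem_erase hi')]]
      omega
    rw [hs, hT.count_eq]
    by_cases e : j' = j
    · subst e; simp [hj]
    · simp [e]
  · have hi := tourWeight_insert_le I.wH_symm I.wH_triangle h h'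
    have hw := hT.weight_le
    unfold mtspWeight at hw ⊢
    rw [← Finset.add_sum_erase _ _ (Finset.mem_univ i)] at hw ⊢
    rw [Finset.sum_congr rfl fun i' hi' => by rw [hne i' (Finset.ne_of_mem_erase hi')]]
    linarith
  · obtain ⟨Ps, h₁, h₂, hc⟩ := hT.completion S hS
    obtain ⟨Qs, g₁, g₂, gc⟩ := I.exists_completion_insert hj hmin h₁ h₂
    exact ⟨Qs, g₁, g₂, by linarith⟩
  · have hnd : ∀ i, ((I.tourList T i).map I.vertexId).Nodup := fun i =>
      (List.nodup_map_iff I.vertexId_injective).2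
        (List.nodup_iff_count_le_one.2 (I.count_tourList_le A hT.count_eq i))
    have hjm : ∀ i, I.vertexId (Sum.inr j) ∉ (I.tourList T i).map I.vertexId := fun i hm =>
      hjmem i ((List.mem_map_of_injective I.vertexId_injective).1 hm)
    -- The tours are disjoint, so the two pointer changes do not affect the tours that do not
    -- contain `p`.
    by_cases e : i' = i
    · subst e
      have a₁ := hnx i'
      have a₂ := hnd i'
      have a₃ := hjm i'
      rw [h, List.map_append, List.map_cons] at a₁ a₂ a₃
      rw [h', List.map_append, List.map_cons, List.map_cons]
      exact a₁.insert a₂ a₃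
    · have e' : I.tourList T' i' = I.tourList T i' := by rw [tourList, hne i' e, tourList]
      rw [e']
      refine (hnx i').congr fun x hx => ?_
      have hxj : x ≠ I.vertexId (Sum.inr j) := fun hx' => hjm i' (hx' ▸ hx)
      have hxp : x ≠ I.vertexId p := by
        rintro rfl
        have hpi : p ∈ I.tourList T i := by rw [h]; simp
        exact I.tourList_disjoint A hT.count_eq e hpi
          ((List.mem_map_of_injective I.vertexId_injective).1 hx)
      rw [Function.update_of_ne hxp, Function.update_of_ne hxj]

end Instance

/-! ### Reasoning about programs -/

namespace State

@[simp] theorem writeN_nat (s : State) (a i x b j : ℕ) :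
    (s.writeN a i x).nat b j = if b = a ∧ j = i then x else s.nat b j := by
  by_cases hb : b = a
  · subst hb
    by_cases hj : j = i <;> simp [writeN, hj]
  · simp [writeN, hb]

@[simp] theorem writeN_real (s : State) (a i x : ℕ) : (s.writeN a i x).real = s.real := rfl

@[simp] theorem writeN_tape (s : State) (a i x : ℕ) : (s.writeN a i x).tape = s.tape := rfl

@[simp] theorem writeR_nat (s : State) (a i : ℕ) (x : ℝ) : (s.writeR a i x).nat = s.nat := rfl

@[simp] theorem writeR_real (s : State) (a i : ℕ) (x : ℝ) (b j : ℕ) :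
    (s.writeR a i x).real b j = if b = a ∧ j = i then x else s.real b j := by
  by_cases hb : b = a
  · subst hb
    by_cases hj : j = i <;> simp [writeR, hj]
  · simp [writeR, hb]

@[simp] theorem writeR_tape (s : State) (a i : ℕ) (x : ℝ) : (s.writeR a i x).tape = s.tape := rfl

@[simp] theorem popTape_nat (s : State) : s.popTape.nat = s.nat := rfl

@[simp] theorem popTape_real (s : State) : s.popTape.real = s.real := rfl

@[simp] theorem popTape_tape (s : State) : s.popTape.tape = fun k => s.tape (k + 1) := rfl

end State

namespace Cmd

/-- The arrays of natural numbers that a program can change. -/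
def writesN : Cmd → List ℕ
  | skip => []
  | setN a _ _ => [a]
  | setR _ _ _ => []
  | draw a _ => [a]
  | seq p q => p.writesN ++ q.writesN
  | ite _ p q => p.writesN ++ q.writesN
  | loop _ p => p.writesN

/-- The program does not draw random numbers. -/
def DrawFree : Cmd → Prop
  | skip => True
  | setN _ _ _ => True
  | setR _ _ _ => True
  | draw _ _ => False
  | seq p q => p.DrawFree ∧ q.DrawFree
  | ite _ p q => p.DrawFree ∧ q.DrawFree
  | loop _ p => p.DrawFree

/-- The program does not write real numbers. -/
def RealFree : Cmd → Prop
  | skip => True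
  | setN _ _ _ => True
  | setR _ _ _ => False
  | draw _ _ => True
  | seq p q => p.RealFree ∧ q.RealFree
  | ite _ p q => p.RealFree ∧ q.RealFree
  | loop _ p => p.RealFree

end Cmd

namespace Exec

variable {D : ℕ → ℕ → ℝ} {p : Cmd} {s s' : State} {t : ℕ}

theorem nat_eq (h : Exec D p s s' t) {a : ℕ} (ha : a ∉ p.writesN) : s'.nat a = s.nat a := by
  induction h with
  | skip | setR => rfl
  | setN s b i e =>
    have : a ≠ b := by simpa [Cmd.writesN] using ha
    funext j; simp [this]
  | draw s b i =>
    have : a ≠ b := by simpa [Cmd.writesN] using ha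
    funext j; simp [this]
  | seq _ _ ih₁ ih₂ =>
    simp only [Cmd.writesN, List.mem_append, not_or] at ha
    rw [ih₂ ha.2, ih₁ ha.1]
  | ite_true _ _ ih =>
    simp only [Cmd.writesN, List.mem_append, not_or] at ha
    exact ih ha.1
  | ite_false _ _ ih =>
    simp only [Cmd.writesN, List.mem_append, not_or] at ha
    exact ih ha.2
  | loop_done => rfl
  | loop_step _ _ _ ih₁ ih₂ => rw [ih₂ ha, ih₁ ha]

theorem tape_eq (h : Exec D p s s' t) (hp : p.DrawFree) : s'.tape = s.tape := by
  induction h with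
  | skip | setR | setN => rfl
  | draw => exact hp.elim
  | seq _ _ ih₁ ih₂ => rw [ih₂ hp.2, ih₁ hp.1]
  | ite_true _ _ ih => exact ih hp.1
  | ite_false _ _ ih => exact ih hp.2
  | loop_done => rfl
  | loop_step _ _ _ ih₁ ih₂ => rw [ih₂ hp, ih₁ hp]

theorem real_eq (h : Exec D p s s' t) (hp : p.RealFree) : s'.real = s.real := by
  induction h with
  | skip | setN | draw => rfl
  | setR => exact hp.elim
  | seq _ _ ih₁ ih₂ => rw [ih₂ hp.2, ih₁ hp.1]
  | ite_true _ _ ih => exact ih hp.1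
  | ite_false _ _ ih => exact ih hp.2
  | loop_done => rfl
  | loop_step _ _ _ ih₁ ih₂ => rw [ih₂ hp, ih₁ hp]

end Exec

/-- The same memory with another random tape. -/
def State.retape (s : State) (ω : ℕ → ℕ) : State := { s with tape := ω }

theorem NExp.eval_retape (s : State) (ω : ℕ → ℕ) (e : NExp) : e.eval (s.retape ω) = e.eval s := by
  induction e with
  | const k => rfl
  | read a i ih => simp only [NExp.eval, ih]; rfl
  | add e f ih₁ ih₂ | sub e f ih₁ ih₂ => simp only [NExp.eval, ih₁, ih₂]

theorem RExp.eval_retape (D : ℕ → ℕ → ℝ) (s : State) (ω : ℕ → ℕ) (e : RExp) :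
    e.eval D (s.retape ω) = e.eval D s := by
  induction e with
  | read a i => simp only [RExp.eval, NExp.eval_retape]; rfl
  | dist u v => simp only [RExp.eval, NExp.eval_retape]
  | add e f ih₁ ih₂ | sub e f ih₁ ih₂ => simp only [RExp.eval, ih₁, ih₂]

theorem Test.holds_retape (D : ℕ → ℕ → ℝ) (s : State) (ω : ℕ → ℕ) (b : Test) :
    b.Holds D (s.retape ω) ↔ b.Holds D s := by
  induction b with
  | ltN e f => simp only [Test.Holds, NExp.eval_retape]
  | ltR e f => simp only [Test.Holds, RExp.eval_retape]
  | neg b ih => simp only [Test.Holds, ih]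
  | conj b c ih₁ ih₂ => simp only [Test.Holds, ih₁, ih₂]

/-- A program without draws ignores the random tape. -/
theorem Exec.retape {D : ℕ → ℕ → ℝ} {p : Cmd} {s s' : State} {t : ℕ} (h : Exec D p s s' t)
    (hp : p.DrawFree) (ω : ℕ → ℕ) : Exec D p (s.retape ω) (s'.retape ω) t := by
  induction h with
  | skip s => exact .skip _
  | setN s a i e =>
    have := Exec.setN (D := D) (s.retape ω) a i e
    rwa [NExp.eval_retape, NExp.eval_retape] at this
  | setR s a i e =>
    have := Exec.setR (D := D) (s.retape ω) a i e
    rwa [NExp.eval_retape, RExp.eval_retape] at this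
  | draw => exact hp.elim
  | seq _ _ ih₁ ih₂ => exact .seq (ih₁ hp.1) (ih₂ hp.2)
  | ite_true hb _ ih => exact .ite_true ((Test.holds_retape D _ ω _).2 hb) (ih hp.1)
  | ite_false hb _ ih =>
    exact .ite_false (fun h => hb ((Test.holds_retape D _ ω _).1 h)) (ih hp.2)
  | loop_done hb => exact .loop_done fun h => hb ((Test.holds_retape D _ ω _).1 h)
  | loop_step hb _ _ ih₁ ih₂ =>
    exact .loop_step ((Test.holds_retape D _ ω _).2 hb) (ih₁ hp) (ih₂ hp)

/-- The program halts, and its final state and its running time satisfy `Q`. -/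
def Halts (D : ℕ → ℕ → ℝ) (p : Cmd) (s : State) (Q : State → ℕ → Prop) : Prop :=
  ∃ s' t, Exec D p s s' t ∧ Q s' t

namespace Halts

variable {D : ℕ → ℕ → ℝ} {p q : Cmd} {b : Test} {s : State} {Q Q' : State → ℕ → Prop}

theorem skip (h : Q s 1) : Halts D .skip s Q := ⟨_, _, .skip s, h⟩

theorem setN {a : ℕ} {i e : NExp}
    (h : Q (s.writeN a (i.eval s) (e.eval s)) (i.cost + e.cost + 1)) : Halts D (.setN a i e) s Q :=
  ⟨_, _, .setN s a i e, h⟩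

theorem setR {a : ℕ} {i : NExp} {e : RExp}
    (h : Q (s.writeR a (i.eval s) (e.eval D s)) (i.cost + e.cost + 1)) :
    Halts D (.setR a i e) s Q :=
  ⟨_, _, .setR s a i e, h⟩

theorem draw {a : ℕ} {i : NExp}
    (h : Q (s.writeN a (i.eval s) (s.tape 0)).popTape (i.cost + 1)) : Halts D (.draw a i) s Q :=
  ⟨_, _, .draw s a i, h⟩

theorem seq (h : Halts D p s fun s' t => Halts D q s' fun s'' u => Q s'' (t + u)) :
    Halts D (.seq p q) s Q := by
  obtain ⟨s₁, t, h₁, s₂, u, h₂, hQ⟩ := h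
  exact ⟨s₂, t + u, .seq h₁ h₂, hQ⟩

theorem ite (h₁ : b.Holds D s → Halts D p s fun s' t => Q s' (b.cost + t + 1))
    (h₂ : ¬ b.Holds D s → Halts D q s fun s' t => Q s' (b.cost + t + 1)) :
    Halts D (.ite b p q) s Q := by
  by_cases hb : b.Holds D s
  · obtain ⟨s', t, h, hQ⟩ := h₁ hb
    exact ⟨s', _, .ite_true hb h, hQ⟩
  · obtain ⟨s', t, h, hQ⟩ := h₂ hb
    exact ⟨s', _, .ite_false hb h, hQ⟩

theorem loop_done (hb : ¬ b.Holds D s) (h : Q s (b.cost + 1)) : Halts D (.loop b p) s Q :=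
  ⟨_, _, .loop_done hb, h⟩

theorem loop_step (hb : b.Holds D s)
    (h : Halts D p s fun s' t => Halts D (.loop b p) s' fun s'' u => Q s'' (b.cost + t + u + 1)) :
    Halts D (.loop b p) s Q := by
  obtain ⟨s₁, t, h₁, s₂, u, h₂, hQ⟩ := h
  exact ⟨s₂, _, .loop_step hb h₁ h₂, hQ⟩

theorem mono (h : Halts D p s Q) (hQ : ∀ s' t, Q s' t → Q' s' t) : Halts D p s Q' := by
  obtain ⟨s', t, h, hq⟩ := h
  exact ⟨s', t, h, hQ _ _ hq⟩

/-- What a program does not write stays unchanged. -/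
theorem frame (h : Halts D p s Q)
    (hQ : ∀ s' t, Q s' t → (∀ a, a ∉ p.writesN → s'.nat a = s.nat a) →
      (p.RealFree → s'.real = s.real) → (p.DrawFree → s'.tape = s.tape) → Q' s' t) :
    Halts D p s Q' := by
  obtain ⟨s', t, h, hq⟩ := h
  exact ⟨s', t, h, hQ _ _ hq (fun _ ha => h.nat_eq ha) h.real_eq h.tape_eq⟩

/-- A loop that makes exactly `n` rounds, with an invariant. -/
theorem loop (Inv : ℕ → State → Prop) (n c : ℕ)
    (hstep : ∀ k < n, ∀ s, Inv k s → b.Holds D s ∧ Halts D p s fun s' t => Inv (k + 1) s' ∧ t ≤ c)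
    (hend : ∀ s, Inv n s → ¬ b.Holds D s) (h₀ : Inv 0 s) :
    Halts D (.loop b p) s fun s' t => Inv n s' ∧ t ≤ n * (c + b.cost + 1) + (b.cost + 1) := by
  suffices H : ∀ r k s, k + r = n → Inv k s →
      Halts D (.loop b p) s fun s' t => Inv n s' ∧ t ≤ r * (c + b.cost + 1) + (b.cost + 1) from
    H n 0 s (Nat.zero_add n) h₀
  intro r
  induction r with
  | zero =>
    rintro k s hk hI
    have hk' : k = n := by omega
    subst hk'
    exact loop_done (hend s hI) ⟨hI, by omega⟩
  | succ r ih =>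
    rintro k s hk hI
    obtain ⟨hb, hp⟩ := hstep k (by omega) s hI
    refine loop_step hb (hp.mono ?_)
    rintro s' t ⟨hI', ht⟩
    refine (ih (k + 1) s' (by omega) hI').mono ?_
    rintro s'' u ⟨hI'', hu⟩
    refine ⟨hI'', ?_⟩
    have : (r + 1) * (c + b.cost + 1) = r * (c + b.cost + 1) + (c + b.cost + 1) := by ring
    omega

end Halts

/-! ### The program: spanning forest and tours

Array `6` holds the pointers of the tours. For every request, array `7` holds its nearest vertex in the
forest (increased by one), the real array `0` the distance to it, and array `8` whether the request has
been added to the forest. -/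

/-- The variable that is kept in the first entry of an array. -/
def scalar (a : ℕ) : NExp := .read a (.const 0)

def numVehicles : NExp := .read 0 (.const 1)

def numRequests : NExp := .read 0 (.const 2)

def capacity : NExp := .read 0 (.const 3)

/-- `for x < n do p` -/
def forLoop (x : ℕ) (n : NExp) (p : Cmd) : Cmd :=
  .seq (.setN x (.const 0) (.const 0))
    (.loop (.ltN (scalar x) n) (.seq p (.setN x (.const 0) (.add (scalar x) (.const 1)))))

/-- The distance in `H` of request `13` from the vertex with locations `11` and `12`. -/
def distance : RExp :=
  .add (.dist (scalar 11) (.read 1 (scalar 13))) (.dist (scalar 12) (.read 2 (scalar 13)))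

/-- Update the nearest vertices when vertex `10` with the locations `11` and `12` is added. -/
def relax : Cmd :=
  forLoop 13 numRequests
    (.ite (.neg (.conj (.ltN (.const 0) (.read 7 (scalar 13)))
        (.neg (.ltR distance (.read 0 (scalar 13))))))
      (.seq (.setR 0 (scalar 13) distance)
        (.setN 7 (scalar 13) (.add (scalar 10) (.const 1))))
      .skip)

/-- Let variable `15` be the request outside of the forest that is nearest to the forest. -/
def select : Cmd :=
  .seq (.setN 15 (.const 0) numRequests)
    (forLoop 13 numRequests
      (.ite (.conj (.neg (.ltN (.const 0) (.read 8 (scalar 13))))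
          (.neg (.conj (.ltN (scalar 15) numRequests)
            (.neg (.ltR (.read 0 (scalar 13)) (.read 0 (scalar 15)))))))
        (.setN 15 (.const 0) (scalar 13))
        .skip))

/-- Add request `15` to the forest, behind its nearest vertex. -/
def attach : Cmd :=
  .seq (.setN 16 (.const 0) (.sub (.read 7 (scalar 15)) (.const 1)))
    (.seq (.setN 10 (.const 0) (.add numVehicles (scalar 15)))
      (.seq (.setN 6 (scalar 10) (.read 6 (scalar 16)))
        (.seq (.setN 6 (scalar 16) (scalar 10))
          (.seq (.setN 8 (scalar 15) (.const 1))
            (.seq (.setN 11 (.const 0) (.read 1 (scalar 15)))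
              (.setN 12 (.const 0) (.read 2 (scalar 15))))))))

/-- The depots are the roots of the forest: nothing has to be linked, only the nearest vertices are
updated. The location of a depot serves both as its source and as its destination. -/
def addDepots : Cmd :=
  forLoop 14 numVehicles
    (.seq (.setN 10 (.const 0) (scalar 14))
      (.seq (.setN 11 (.const 0) (.read 3 (scalar 14)))
        (.seq (.setN 12 (.const 0) (.read 3 (scalar 14))) relax)))

def addRequests : Cmd :=
  forLoop 14 numRequests (.seq select (.seq attach relax))

/-- A counting loop with an invariant. -/
theorem Halts.forLoop {D : ℕ → ℕ → ℝ} {x : ℕ} {e : NExp} {p : Cmd} {s : State}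
    (Inv : ℕ → State → Prop) (n c : ℕ) (he : ∀ k s, Inv k s → s.nat x 0 = k ∧ e.eval s = n)
    (hstep : ∀ k < n, ∀ s, Inv k s →
      Halts D p s fun s' t => s'.nat x 0 = k ∧ Inv (k + 1) (s'.writeN x 0 (k + 1)) ∧ t ≤ c)
    (h₀ : Inv 0 (s.writeN x 0 0)) :
    Halts D (MDaRP.forLoop x e p) s fun s' t => Inv n s' ∧ t ≤ n * (c + e.cost + 10) + e.cost + 7 := by
  refine Halts.seq (Halts.setN ((Halts.loop Inv n (c + 6) ?_ ?_ h₀).mono ?_))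
  · intro k hk s hI
    obtain ⟨h1, h2⟩ := he k s hI
    refine ⟨by simp only [Test.Holds, scalar, NExp.eval, h1, h2, hk],
      Halts.seq ((hstep k hk s hI).mono ?_)⟩
    rintro s' t ⟨h3, h4, ht⟩
    refine Halts.setN ?_
    simp only [scalar, NExp.eval, h3, NExp.cost]
    exact ⟨h4, by omega⟩
  · intro s hI
    obtain ⟨h1, h2⟩ := he n s hI
    simp only [Test.Holds, scalar, NExp.eval, h1, h2, lt_self_iff_false, not_false_eq_true]
  · rintro s' t ⟨hI, ht⟩
    refine ⟨hI, ?_⟩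
    simp only [Test.cost, scalar, NExp.cost] at ht ⊢
    have : n * (c + 6 + (1 + 1 + e.cost + 1) + 1) = n * (c + e.cost + 10) := by ring
    omega

/-! ### Prim's algorithm on the machine: correctness and running time -/

namespace Instance

variable (I : Instance)

/-- The input arrays are unchanged. -/
def HasInput (s : State) : Prop := ∀ a < 4, s.nat a = (I.initState fun _ => 0).nat a

namespace HasInput

variable {I} {s : State} (hs : I.HasInput s)

include hs

theorem numVehicles : s.nat 0 1 = I.h := by rw [hs 0 (by omega)]; rfl

theorem numRequests : s.nat 0 2 = I.m := by rw [hs 0 (by omega)]; rfl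

theorem capacity : s.nat 0 3 = I.cap := by rw [hs 0 (by omega)]; rfl

theorem src (j : Fin I.m) : s.nat 1 j = I.src j := by
  rw [hs 1 (by omega)]; simp [initState]

theorem dst (j : Fin I.m) : s.nat 2 j = I.dst j := by
  rw [hs 2 (by omega)]; simp [initState]

theorem depot (i : Fin I.h) : s.nat 3 i = I.depot i := by
  rw [hs 3 (by omega)]; simp [initState]

theorem congr {s' : State} (h : ∀ a < 4, s'.nat a = s.nat a) : I.HasInput s' :=
  fun a ha => (h a ha).trans (hs a ha)

theorem writeN {a : ℕ} (ha : 4 ≤ a) (i x : ℕ) : I.HasInput (s.writeN a i x) :=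
  hs.congr fun b hb => by funext k; simp; omega

theorem writeR (a i : ℕ) (x : ℝ) : I.HasInput (s.writeR a i x) := hs

end HasInput

theorem table_eq (a b : Fin I.n) : I.table a b = I.w a b := by simp [table]

/-- Request `j` knows its nearest vertex in `B`. -/
def Nearest (s : State) (B : Set (Fin I.h ⊕ Fin I.m)) (j : Fin I.m) : Prop :=
  (s.nat 7 j = 0 ∧ B = ∅) ∨ ∃ p ∈ B, s.nat 7 j = I.vertexId p + 1 ∧
    s.real 0 j = I.wH p (Sum.inr j) ∧ ∀ u ∈ B, I.wH p (Sum.inr j) ≤ I.wH u (Sum.inr j)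

theorem halts_relax (v : Fin I.h ⊕ Fin I.m) (B : Set (Fin I.h ⊕ Fin I.m)) {s : State}
    (hs : I.HasInput s) (h10 : s.nat 10 0 = I.vertexId v)
    (h11 : s.nat 11 0 = Sum.elim I.depot I.src v) (h12 : s.nat 12 0 = Sum.elim I.depot I.dst v)
    (hB : ∀ j, I.Nearest s B j) :
    Halts I.table relax s fun s' t => (∀ j, I.Nearest s' (insert v B) j) ∧ t ≤ 100 * I.m + 100 := by
  -- Before round `k`, the requests below `k` refer to the enlarged set, the others still to `B`.
  refine (Halts.forLoop (fun k s => s.nat 13 0 = k ∧ I.HasInput s ∧ s.nat 10 0 = I.vertexId v ∧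
    s.nat 11 0 = Sum.elim I.depot I.src v ∧ s.nat 12 0 = Sum.elim I.depot I.dst v ∧
    (∀ j : Fin I.m, (j : ℕ) < k → I.Nearest s (insert v B) j) ∧
    ∀ j : Fin I.m, k ≤ j → I.Nearest s B j) I.m 70 ?_ ?_ ?_).mono ?_
  · rintro k s ⟨h, hs, -⟩
    exact ⟨h, hs.numRequests⟩
  · rintro k hk s ⟨h13, hs, h10, h11, h12, hlt, hge⟩
    set j : Fin I.m := ⟨k, hk⟩ with hj
    have hdist : distance.eval I.table s = I.wH v (Sum.inr j) := by
      simp only [distance, RExp.eval, scalar, NExp.eval, h11, h12, h13]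
      rw [show s.nat 1 k = _ from hs.src j, show s.nat 2 k = _ from hs.dst j, table_eq, table_eq,
        wH_eq]
      rfl
    refine Halts.ite (fun hb => Halts.seq (Halts.setR (Halts.setN ?_))) (fun hb => Halts.skip ?_)
    · refine ⟨by simp [h13], ⟨by simp, ?_, ?_, ?_, ?_, ?_, ?_⟩, by decide⟩
      · exact ((hs.writeR _ _ _).writeN (by omega) _ _).writeN (by omega) _ _
      · simpa using h10
      · simpa using h11
      · simpa using h12
      · intro j' hj'
        rcases (Nat.lt_succ_iff.1 hj').eq_or_lt with e | e
        · have e' : j' = j := Fin.ext e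
          subst e'
          -- The test succeeds if no nearest vertex is known, and then `B` is empty, or if `v` is
          -- strictly closer.
          have hbetter : ∀ u ∈ B, I.wH v (Sum.inr j) ≤ I.wH u (Sum.inr j) := by
            rcases hge j le_rfl with ⟨-, h0⟩ | ⟨p, hp, h7, h0, hle⟩
            · simp [h0]
            · have h7' : s.nat 7 k = I.vertexId p + 1 := h7
              have h0' : s.real 0 k = I.wH p (Sum.inr j) := h0
              simp only [Test.Holds, hdist, scalar, NExp.eval, RExp.eval, h13, h7', h0'] at hb
              simp only [Nat.succ_pos, true_and, not_not] at hb
              exact fun u hu => hb.le.trans (hle u hu)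
          refine Or.inr ⟨v, Set.mem_insert _ _, ?_, ?_, ?_⟩
          · simp [scalar, NExp.eval, h13, h10, hj]
          · simp [scalar, NExp.eval, h13, hj, hdist]
          · rintro u (rfl | hu)
            · exact le_rfl
            · exact hbetter u hu
        · have hne : (j' : ℕ) ≠ k := by omega
          have := hlt j' e
          simpa [Nearest, scalar, NExp.eval, h13, hne] using this
      · intro j' hj'
        have hne : (j' : ℕ) ≠ k := by omega
        have := hge j' (by omega)
        simpa [Nearest, scalar, NExp.eval, h13, hne] using this
    · refine ⟨h13, ⟨by simp, hs.writeN (by omega) _ _, by simpa using h10, by simpa using h11,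
        by simpa using h12, ?_, ?_⟩, by decide⟩
      · intro j' hj'
        rcases (Nat.lt_succ_iff.1 hj').eq_or_lt with e | e
        · have e' : j' = j := Fin.ext e
          subst e'
          simp only [Test.Holds, not_not, hdist, scalar, NExp.eval, RExp.eval, h13] at hb
          have h := hge j le_rfl
          simp only [Nearest, hj] at h ⊢
          rcases h with ⟨h7, -⟩ | ⟨p, hp, h7, h0, hle⟩
          · rw [h7] at hb; exact absurd hb.1 (lt_irrefl _)
          · rw [h0] at hb
            refine Or.inr ⟨p, Set.mem_insert_of_mem _ hp, by simpa using h7, by simpa using h0, ?_⟩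
            rintro u (rfl | hu)
            · exact not_lt.1 hb.2
            · exact hle u hu
        · simpa [Nearest] using hlt j' e
      · intro j' hj'
        simpa [Nearest] using hge j' (by omega)
  · refine ⟨by simp, hs.writeN (by omega) _ _, by simpa using h10, by simpa using h11,
      by simpa using h12, by simp, ?_⟩
    intro j _
    simpa [Nearest] using hB j
  · rintro s' t ⟨⟨-, -, -, -, -, h, -⟩, ht⟩
    refine ⟨fun j => h j j.2, ht.trans ?_⟩
    simp only [MDaRP.numRequests, NExp.cost]
    omega

theorem halts_addDepots {s : State} (hs : I.HasInput s) (h7 : ∀ j, s.nat 7 j = 0) :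
    Halts I.table addDepots s fun s' t => I.HasInput s' ∧
      (∀ j, I.Nearest s' {v | I.InForest ∅ v} j) ∧ t ≤ I.h * (100 * I.m + 200) + 100 := by
  refine (Halts.forLoop (fun k s => s.nat 14 0 = k ∧ I.HasInput s ∧
    ∀ j, I.Nearest s {v | ∃ i : Fin I.h, (i : ℕ) < k ∧ v = Sum.inl i} j) I.h
      (100 * I.m + 150) ?_ ?_ ?_).mono ?_
  · rintro k s ⟨h, hs, -⟩
    exact ⟨h, hs.numVehicles⟩
  · rintro k hk s ⟨h14, hs, hB⟩
    have hd : s.nat 3 k = _ := hs.depot ⟨k, hk⟩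
    refine Halts.seq (Halts.setN (Halts.seq (Halts.setN (Halts.seq (Halts.setN
      ((I.halts_relax (Sum.inl ⟨k, hk⟩) {v | ∃ i : Fin I.h, (i : ℕ) < k ∧ v = Sum.inl i} ?_ ?_ ?_ ?_ ?_).frame ?_))))))
    · iterate 3 refine HasInput.writeN ?_ (by omega) _ _
      exact hs
    · simp [scalar, NExp.eval, h14, vertexId]
    · simp [scalar, NExp.eval, h14, hd]
    · simp [scalar, NExp.eval, h14, hd]
    · intro j
      simpa [Nearest] using hB j
    · rintro s' t ⟨hN, ht⟩ hfr - -
      refine ⟨?_, ⟨by simp, ?_, fun j => ?_⟩, ?_⟩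
      · rw [hfr 14 (by decide)]; simp [h14]
      · refine HasInput.writeN (HasInput.congr ?_ fun a ha => hfr a ?_) (by omega) _ _
        · iterate 3 refine HasInput.writeN ?_ (by omega) _ _
          exact hs
        · simp [relax, forLoop, Cmd.writesN]; omega
      · have e : {v : Fin I.h ⊕ Fin I.m | ∃ i : Fin I.h, (i : ℕ) < k + 1 ∧ v = Sum.inl i} =
            insert (Sum.inl ⟨k, hk⟩) {v | ∃ i : Fin I.h, (i : ℕ) < k ∧ v = Sum.inl i} := by
          ext v
          simp only [Set.mem_ofPred_eq, Set.mem_insert_iff]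
          constructor
          · rintro ⟨i, hi, rfl⟩
            rcases (Nat.lt_succ_iff.1 hi).eq_or_lt with e | e
            · exact Or.inl (congrArg _ (Fin.ext e))
            · exact Or.inr ⟨i, e, rfl⟩
          · rintro (rfl | ⟨i, hi, rfl⟩)
            · exact ⟨_, Nat.lt_succ_self _, rfl⟩
            · exact ⟨i, by omega, rfl⟩
        rw [e]
        simpa [Nearest] using hN j
      · simp only [scalar, NExp.cost]
        omega
  · refine ⟨by simp, hs.writeN (by omega) _ _, fun j => Or.inl ⟨by simp [h7], by simp⟩⟩
  · rintro s' t ⟨⟨-, hs', h⟩, ht⟩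
    refine ⟨hs', fun j => ?_, ht.trans ?_⟩
    · convert h j using 1
      ext v
      rcases v with i | j <;> simp [InForest]
    · simp only [MDaRP.numVehicles, NExp.cost]
      nlinarith

/-- The start value `m` of variable `15` is not a request and means that no candidate has been
found. As `A` is not everything, it gets replaced. -/
theorem halts_select (A : Finset (Fin I.m)) (hA : A.card < I.m) {s : State} (hs : I.HasInput s)
    (h8 : ∀ j : Fin I.m, s.nat 8 j = if j ∈ A then 1 else 0) :
    Halts I.table select s fun s' t => (∃ b : Fin I.m, s'.nat 15 0 = b ∧ b ∉ A ∧
      ∀ j : Fin I.m, j ∉ A → s.real 0 b ≤ s.real 0 j) ∧ t ≤ 100 * I.m + 100 := by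
  refine Halts.seq (Halts.setN ((Halts.forLoop (fun k s' => s'.nat 13 0 = k ∧ I.HasInput s' ∧
    s'.nat 8 = s.nat 8 ∧ s'.real = s.real ∧
    ((s'.nat 15 0 = I.m ∧ ∀ j : Fin I.m, (j : ℕ) < k → j ∈ A) ∨
      ∃ b : Fin I.m, s'.nat 15 0 = b ∧ b ∉ A ∧
        ∀ j : Fin I.m, (j : ℕ) < k → j ∉ A → s.real 0 b ≤ s.real 0 j)) I.m 50 ?_ ?_ ?_).mono ?_))
  · rintro k s ⟨h, hs, -⟩
    exact ⟨h, hs.numRequests⟩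
  · rintro k hk s' ⟨h13, hs', e8, er, hbest⟩
    set j : Fin I.m := ⟨k, hk⟩ with hj
    have h8k : s.nat 8 k = if j ∈ A then 1 else 0 := h8 j
    refine Halts.ite (fun hb => Halts.setN ?_) (fun hb => Halts.skip ?_)
    · simp only [Test.Holds, scalar, NExp.eval, RExp.eval, h13, e8, er, h8k, MDaRP.numRequests,
        hs'.numRequests] at hb
      have hjA : j ∉ A := fun h => by simp [h] at hb
      refine ⟨by simp [h13], ⟨by simp, ?_, ?_, by simpa using er, Or.inr ⟨j, ?_, hjA, ?_⟩⟩,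
        by decide⟩
      · exact (hs'.writeN (by omega) _ _).writeN (by omega) _ _
      · rw [← e8]; funext i; simp
      · simp [scalar, NExp.eval, h13, hj]
      · intro j' hj' hj'A
        rcases (Nat.lt_succ_iff.1 hj').eq_or_lt with e | e
        · have e' : j' = j := Fin.ext e
          rw [e']
        · rcases hbest with ⟨-, hall⟩ | ⟨b, hb15, hbA, hmin⟩
          · exact absurd (hall j' e) hj'A
          · have h2 := hb.2
            rw [hb15] at h2
            simp only [b.2, true_and, not_not] at h2
            exact h2.le.trans (hmin j' e hj'A)
    · refine ⟨h13, ⟨by simp, hs'.writeN (by omega) _ _, ?_, by simpa using er, ?_⟩, by decide⟩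
      · rw [← e8]; funext i; simp
      simp only [Test.Holds, scalar, NExp.eval, RExp.eval, h13, e8, er, h8k, MDaRP.numRequests,
        hs'.numRequests] at hb
      rcases hbest with ⟨hb15, hall⟩ | ⟨b, hb15, hbA, hmin⟩
      · refine Or.inl ⟨by simpa using hb15, fun j' hj' => ?_⟩
        rcases (Nat.lt_succ_iff.1 hj').eq_or_lt with e | e
        · have e' : j' = j := Fin.ext e
          rw [e']
          by_contra hjA
          simp [hjA, hb15] at hb
        · exact hall j' e
      · refine Or.inr ⟨b, by simpa using hb15, hbA, fun j' hj' hj'A => ?_⟩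
        rcases (Nat.lt_succ_iff.1 hj').eq_or_lt with e | e
        · have e' : j' = j := Fin.ext e
          rw [e'] at hj'A ⊢
          rw [hb15] at hb
          simp only [hj'A, if_false, lt_self_iff_false, not_false_eq_true, true_and, b.2,
            not_not, not_lt] at hb
          exact hb
        · exact hmin j' e hj'A
  · refine ⟨by simp, (hs.writeN (by omega) _ _).writeN (by omega) _ _, by funext i; simp, rfl,
      Or.inl ⟨?_, by simp⟩⟩
    simp [NExp.eval, MDaRP.numRequests, hs.numRequests]
  · rintro s' t ⟨⟨-, -, -, -, hbest⟩, ht⟩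
    refine ⟨?_, ?_⟩
    · rcases hbest with ⟨-, hall⟩ | ⟨b, hb15, hbA, hmin⟩
      · have : A = Finset.univ := Finset.eq_univ_of_forall fun j => hall j j.2
        rw [this, Finset.card_univ, Fintype.card_fin] at hA
        exact absurd hA (lt_irrefl _)
      · exact ⟨b, hb15, hbA, fun j => hmin j j.2⟩
    · simp only [MDaRP.numRequests, NExp.cost] at ht ⊢
      omega

/-- The state between two rounds of Prim's algorithm. -/
def HasForest (s : State) (k : ℕ) (T : I.Tours) : Prop :=
  ∃ (A : Finset (Fin I.m)) (c : ℝ), A.card = k ∧ I.IsPartialSolution A T c ∧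
    I.IsLinked (s.nat 6) T ∧ (∀ j : Fin I.m, s.nat 8 j = if j ∈ A then 1 else 0) ∧
    ∀ j, I.Nearest s {v | I.InForest A v} j

theorem halts_addRequest {k : ℕ} (hk : k < I.m) {T : I.Tours} {s : State} (hs : I.HasInput s)
    (hT : I.HasForest s k T) :
    Halts I.table (.seq select (.seq attach relax)) s fun s' t =>
      (∃ T', I.HasForest s' (k + 1) T') ∧ t ≤ 200 * I.m + 300 := by
  obtain ⟨A, c, hAk, hpart, hlink, h8, hnear⟩ := hT
  refine Halts.seq ((I.halts_select A (hAk ▸ hk) hs h8).frame ?_)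
  rintro s₁ t₁ ⟨⟨b, hb15, hbA, hbmin⟩, ht₁⟩ hfr hreal -
  have hs₁ : I.HasInput s₁ := hs.congr fun a ha => hfr a (by
    simp [select, forLoop, Cmd.writesN]; omega)
  have e6 := hfr 6 (by decide)
  have e7 := hfr 7 (by decide)
  have e8 := hfr 8 (by decide)
  have er : s₁.real = s.real := hreal (by simp [select, forLoop, Cmd.RealFree])
  -- There is at least one depot, so the forest is never empty and every request knows a nearest
  -- vertex.
  have hsome : ∀ j : Fin I.m, ∃ p, I.InForest A p ∧ s.nat 7 j = I.vertexId p + 1 ∧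
      s.real 0 j = I.wH p (Sum.inr j) ∧
      ∀ u, I.InForest A u → I.wH p (Sum.inr j) ≤ I.wH u (Sum.inr j) := fun j => by
    rcases hnear j with ⟨-, h⟩ | h
    · have : (Sum.inl ⟨0, I.h_pos⟩ : Fin I.h ⊕ Fin I.m) ∈ {v | I.InForest A v} := trivial
      rw [h] at this
      exact this.elim
    · exact h
  obtain ⟨p, hp, hp7, hp0, hpmin⟩ := hsome b
  -- The smallest of the distances to nearest vertices is the minimum over all pairs of a forest
  -- vertex and an outside request.
  obtain ⟨T', hT', hlink'⟩ := hpart.exists_insert hlink hbA hp fun u hu j hj => by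
    obtain ⟨q, hq, -, hq0, hqmin⟩ := hsome j
    have := hbmin j hj
    rw [hp0, hq0] at this
    exact this.trans (hqmin u hu)
  have hpv : I.vertexId p ≠ I.vertexId (Sum.inr b) := fun h => by
    rw [I.vertexId_injective h] at hp
    exact hbA hp
  have hvb : I.vertexId (Sum.inr b) = I.h + b := rfl
  rw [hvb] at hpv hlink'
  refine Halts.seq (Halts.seq (Halts.setN (Halts.seq (Halts.setN (Halts.seq (Halts.setN
    (Halts.seq (Halts.setN (Halts.seq (Halts.setN (Halts.seq (Halts.setN (Halts.setN
      ((I.halts_relax (Sum.inr b) {v | I.InForest A v} ?_ ?_ ?_ ?_ ?_).frame ?_))))))))))))))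
  · iterate 7 refine HasInput.writeN ?_ (by omega) _ _
    exact hs₁
  · simp [scalar, NExp.eval, MDaRP.numVehicles, hs₁.numVehicles, hb15, vertexId]
  · simp [scalar, NExp.eval, hb15, hs₁.src]
  · simp [scalar, NExp.eval, hb15, hs₁.dst]
  · intro j
    simpa [Nearest, e7, er] using hnear j
  · rintro s₂ t₂ ⟨hN, ht₂⟩ hfr₂ - -
    refine ⟨⟨T', insert b A, c + I.wH p (Sum.inr b), ?_, hT', ?_, ?_, ?_⟩, ?_⟩
    · rw [Finset.card_insert_of_notMem hbA, hAk]
    · rw [hfr₂ 6 (by decide)]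
      convert hlink' using 1
      funext x
      by_cases h1 : x = I.vertexId p
      · subst h1
        simp [scalar, NExp.eval, MDaRP.numVehicles, hs₁.numVehicles, hb15, e6, e7, hp7]
      · by_cases h2 : x = I.h + b
        · subst h2
          simp [scalar, NExp.eval, MDaRP.numVehicles, hs₁.numVehicles, hb15, e6, e7, hp7,
            hpv.symm]
        · simp [scalar, NExp.eval, MDaRP.numVehicles, hs₁.numVehicles, hb15, e6, e7, hp7, h1, h2]
    · intro j
      rw [hfr₂ 8 (by decide)]
      by_cases hj : j = b
      · subst hj
        simp [scalar, NExp.eval, hb15]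
      · have hj' : (j : ℕ) ≠ b := fun h => hj (Fin.ext h)
        simp [scalar, NExp.eval, hb15, hj, hj', e8, h8]
    · intro j
      convert hN j using 1
      ext v
      rcases v with i | q <;> simp [InForest]
    · simp only [scalar, NExp.cost, MDaRP.numVehicles]
      omega

theorem halts_addRequests {s : State} (hs : I.HasInput s) {T : I.Tours} (hT : I.HasForest s 0 T) :
    Halts I.table addRequests s fun s' t => I.HasInput s' ∧ (∃ T', I.HasForest s' I.m T') ∧
      t ≤ I.m * (200 * I.m + 400) + 100 := by
  refine (Halts.forLoop (fun k s => s.nat 14 0 = k ∧ I.HasInput s ∧ ∃ T, I.HasForest s k T) I.m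
      (200 * I.m + 300) ?_ ?_ ?_).mono ?_
  · rintro k s ⟨h, hs, -⟩
    exact ⟨h, hs.numRequests⟩
  · rintro k hk s ⟨h14, hs, T, hT⟩
    refine (I.halts_addRequest hk hs hT).frame ?_
    rintro s' t ⟨⟨T', hT'⟩, ht⟩ hfr - -
    refine ⟨?_, ⟨by simp, ?_, T', ?_⟩, ht⟩
    · rw [hfr 14 (by decide), h14]
    · refine HasInput.writeN (hs.congr fun a ha => hfr a ?_) (by omega) _ _
      simp [select, attach, relax, forLoop, Cmd.writesN]; omega
    · simpa [HasForest, Nearest, IsLinked, State.writeN] using hT'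
  · exact ⟨by simp, hs.writeN (by omega) _ _, T, by
      simpa [HasForest, Nearest, IsLinked, State.writeN] using hT⟩
  · rintro s' t ⟨⟨-, hs', h⟩, ht⟩
    refine ⟨hs', h, ht.trans ?_⟩
    simp only [MDaRP.numRequests, NExp.cost]
    linarith [Nat.zero_le I.m, Nat.zero_le I.h]

/-- The first part of the program computes a `2`-approximate solution of the multi-depot TSP. -/
theorem halts_tours (ω : ℕ → ℕ) :
    Halts I.table (.seq addDepots addRequests) (I.initState ω) fun s t => I.HasInput s ∧
      (∃ T, I.IsTwoApproxMTSP T ∧ I.IsLinked (s.nat 6) T) ∧ s.nat 4 0 = 0 ∧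
        t ≤ I.h * (100 * I.m + 200) + I.m * (200 * I.m + 400) + 200 := by
  have hs : I.HasInput (I.initState ω) := fun a ha => rfl
  refine (Halts.seq (Q := fun s t => I.HasInput s ∧
      (∃ T, I.IsTwoApproxMTSP T ∧ I.IsLinked (s.nat 6) T) ∧
        t ≤ I.h * (100 * I.m + 200) + I.m * (200 * I.m + 400) + 200)
    ((I.halts_addDepots hs fun j => rfl).frame ?_)).frame ?_
  · rintro s₁ t₁ ⟨hs₁, hnear, ht₁⟩ hfr - -
    refine (I.halts_addRequests hs₁ (T := fun _ => [])
      ⟨∅, 0, rfl, I.isPartialSolution_empty, ?_, ?_, hnear⟩).mono ?_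
    · rw [hfr 6 (by decide)]
      exact I.isLinked_empty
    · intro j
      rw [hfr 8 (by decide)]
      simp [initState]
    · rintro s₂ t₂ ⟨hs₂, ⟨T, A, c, hA, hT, hlink, -⟩, ht₂⟩
      have : A = Finset.univ := (Finset.card_eq_iff_eq_univ A).1 (by rw [hA, Fintype.card_fin])
      subst this
      exact ⟨hs₂, ⟨T, hT.isTwoApproxMTSP, hlink⟩, by omega⟩
  · rintro s t ⟨h1, h2, ht⟩ hfr - -
    refine ⟨h1, h2, ?_, ht⟩
    rw [hfr 4 (by decide)]; rfl

end Instance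

/-! ### The program: cutting the tours and writing the routes

Variable `14` is the vehicle, `17` the first request of the current fragment, `19` the size of this
fragment; `16` runs through the tour and `18` counts down. -/

/-- Append a number to the output. -/
def emit (e : NExp) : Cmd :=
  .seq (.setN 5 (scalar 4) e) (.setN 4 (.const 0) (.add (scalar 4) (.const 1)))

/-- Three times the number of the request at `16`, plus `c`. -/
def stopCode (c : ℕ) : NExp :=
  .add (.add (.sub (scalar 16) numVehicles)
    (.add (.sub (scalar 16) numVehicles) (.sub (scalar 16) numVehicles))) (.const c)

/-- Do `p` for the next `18` requests of the tour, starting with `16`. -/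
def walk (p : Cmd) : Cmd :=
  .loop (.conj (.ltN (.const 0) (scalar 18)) (.ltN (.const 0) (scalar 16)))
    (.seq p (.seq (.setN 16 (.const 0) (.read 6 (scalar 16)))
      (.setN 18 (.const 0) (.sub (scalar 18) (.const 1)))))

/-- Do `p` for the next `n` requests of the tour, starting with `17`. -/
def pass (n : NExp) (p : Cmd) : Cmd :=
  .seq (.setN 16 (.const 0) (scalar 17)) (.seq (.setN 18 (.const 0) n) (walk p))

/-- Each fragment is traced twice, for its pickups and its deliveries. All fragments after the first
have nominal size `cap`; pointer `0` ends the tour. -/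
def writeFragments : Cmd :=
  .loop (.ltN (.const 0) (scalar 17))
    (.seq (pass (scalar 19) (emit (stopCode 2)))
      (.seq (pass (scalar 19) (emit (stopCode 3)))
        (.seq (.setN 17 (.const 0) (scalar 16)) (.setN 19 (.const 0) capacity))))

/-- A number is drawn even if it is not needed, so that vehicle `i` always uses entry `i` of the
tape. An idle pass over `cap` requests detects whether the tour is longer; if not, the first
fragment gets size `cap` and covers the whole tour. -/
def writeRoute : Cmd :=
  .seq (.draw 19 (.const 0))
    (.seq (.setN 17 (.const 0) (.read 6 (scalar 14)))
      (.seq (pass capacity .skip)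
        (.seq (.ite (.ltN (.const 0) (scalar 16)) .skip (.setN 19 (.const 0) capacity))
          (.seq writeFragments (emit (.const 0))))))

/-- The whole algorithm. -/
def algorithm : Cmd :=
  .seq (.seq addDepots addRequests) (forLoop 14 numVehicles writeRoute)

/-- The output consists of the word `W`. -/
def HasOutput (s : State) (W : List ℕ) : Prop :=
  s.nat 4 0 = W.length ∧ ∀ k (hk : k < W.length), s.nat 5 k = W[k]

theorem HasOutput.congr {s s' : State} {W : List ℕ} (h : HasOutput s W) (h4 : s'.nat 4 = s.nat 4)
    (h5 : s'.nat 5 = s.nat 5) : HasOutput s' W := by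
  unfold HasOutput
  rw [h4, h5]
  exact h

theorem HasOutput.writeN {s : State} {W : List ℕ} (h : HasOutput s W) {a : ℕ} (ha : 6 ≤ a)
    (i x : ℕ) : HasOutput (s.writeN a i x) W :=
  h.congr (by funext k; simp; omega) (by funext k; simp; omega)

theorem halts_emit {D : ℕ → ℕ → ℝ} {s : State} {W : List ℕ} (hW : HasOutput s W) (e : NExp) :
    Halts D (emit e) s fun s' t => HasOutput s' (W ++ [e.eval s]) ∧ t ≤ e.cost + 10 := by
  refine Halts.seq (Halts.setN (Halts.setN ⟨⟨?_, ?_⟩, ?_⟩))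
  · simp [scalar, NExp.eval, hW.1]
  · intro k hk
    rw [List.length_append, List.length_singleton] at hk
    rcases (Nat.lt_succ_iff.1 hk).eq_or_lt with h | h
    · subst h
      simp [scalar, NExp.eval, hW.1]
    · rw [List.getElem_append_left h, ← hW.2 k h]
      simp [scalar, NExp.eval, hW.1, h.ne]
  · simp only [scalar, NExp.cost]
    omega

/-! ### Tracing the linked tours: correctness and running time of the output -/

namespace Instance

variable (I : Instance)

/-- The pointers `nx` lead from `c` through the requests of the list. -/
def Points (nx : ℕ → ℕ) : ℕ → List (Fin I.m) → Prop
  | c, [] => c = 0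
  | c, j :: L => c = I.h + j ∧ Points nx (nx c) L

theorem points_of_linked {nx : ℕ → ℕ} {x : ℕ} {L : List (Fin I.m)}
    (h : Linked nx (x :: L.map fun j : Fin I.m => I.h + (j : ℕ))) : I.Points nx (nx x) L := by
  induction L generalizing x with
  | nil => exact h
  | cons j L ih =>
    obtain ⟨h1, h2⟩ := h
    exact ⟨h1, by rw [h1]; exact ih h2⟩

/-- Requests are numbered from `h ≥ 1` on, so `0` is free to mark the end although it is also the
number of the first depot. -/
theorem Points.eq_zero_iff {I : Instance} {nx : ℕ → ℕ} {c : ℕ} {L : List (Fin I.m)}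
    (h : I.Points nx c L) : c = 0 ↔ L = [] := by
  cases L with
  | nil => exact ⟨fun _ => rfl, fun _ => h⟩
  | cons j L =>
    have := h.1
    have := I.h_pos
    simp only [reduceCtorEq, iff_false]
    omega

/-- The program `p` appends the word `g j` to the output when `16` is at request `j`. -/
def Emits (p : Cmd) (g : Fin I.m → List ℕ) : Prop :=
  (∀ a ∈ p.writesN, a = 4 ∨ a = 5) ∧ ∀ s (j : Fin I.m) W, I.HasInput s → HasOutput s W →
    s.nat 16 0 = I.h + (j : ℕ) → Halts I.table p s fun s' t => HasOutput s' (W ++ g j) ∧ t ≤ 50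

theorem emits_skip : I.Emits .skip fun _ => [] :=
  ⟨by simp [Cmd.writesN], fun s j W _ hW _ => Halts.skip ⟨by simpa using hW, by omega⟩⟩

theorem emits_stopCode (c : ℕ) : I.Emits (emit (stopCode c)) fun j => [3 * (j : ℕ) + c] := by
  refine ⟨by simp [emit, Cmd.writesN], fun s j W hs hW h16 => (halts_emit hW _).mono ?_⟩
  rintro s' t ⟨h, ht⟩
  have e : (stopCode c).eval s = 3 * (j : ℕ) + c := by
    simp only [stopCode, scalar, MDaRP.numVehicles, NExp.eval, h16, hs.numVehicles]
    omega
  rw [e] at h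
  exact ⟨h, ht.trans (by simp [stopCode, scalar, MDaRP.numVehicles, NExp.cost])⟩

theorem halts_walk {p : Cmd} {g : Fin I.m → List ℕ} (hp : I.Emits p g) (L : List (Fin I.m)) (q : ℕ)
    {s : State} {W : List ℕ} (hs : I.HasInput s) (hW : HasOutput s W)
    (hL : I.Points (s.nat 6) (s.nat 16 0) L) (hq : s.nat 18 0 = q) :
    Halts I.table (walk p) s fun s' t => HasOutput s' (W ++ (L.take q).flatMap g) ∧
      I.Points (s.nat 6) (s'.nat 16 0) (L.drop q) ∧ t ≤ 100 * (L.take q).length + 10 := by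
  have hfr : ∀ a, 6 ≤ a ∨ a < 4 → a ∉ p.writesN := fun a ha h => by
    have := hp.1 a h
    omega
  induction L generalizing q s W with
  | nil =>
    have h0 : s.nat 16 0 = 0 := hL
    refine Halts.loop_done (by simp [Test.Holds, scalar, NExp.eval, h0]) ⟨by simpa using hW, ?_, ?_⟩
    · simpa [Points] using h0
    · simp [Test.cost, scalar, NExp.cost]
  | cons j L ih =>
    obtain ⟨h16, hL'⟩ := hL
    rcases q with _ | q
    · exact Halts.loop_done (by simp [Test.Holds, scalar, NExp.eval, hq])
        ⟨by simpa using hW, ⟨h16, hL'⟩, by simp [Test.cost, scalar, NExp.cost]⟩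
    · have hpos := I.h_pos
      refine Halts.loop_step ?_ (Halts.seq ((hp.2 s j W hs hW h16).frame ?_))
      · simp only [Test.Holds, scalar, NExp.eval, hq, h16]
        omega
      rintro s₁ t₁ ⟨hW₁, ht₁⟩ hf - -
      have e0 := hf 0 (hfr _ (by omega))
      have e6 := hf 6 (hfr _ (by omega))
      have e16 := hf 16 (hfr _ (by omega))
      have e18 := hf 18 (hfr _ (by omega))
      have hs₁ : I.HasInput s₁ := hs.congr fun a ha => hf a (hfr _ (by omega))
      refine Halts.seq (Halts.setN (Halts.setN ((ih q (W := W ++ g j) ?_ ?_ ?_ ?_).mono ?_)))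
      · iterate 2 refine HasInput.writeN ?_ (by omega) _ _
        exact hs₁
      · iterate 2 refine HasOutput.writeN ?_ (by omega) _ _
        exact hW₁
      · simpa [scalar, NExp.eval, e6, e16, State.writeN] using hL'
      · simp [scalar, NExp.eval, e18, hq]
      · rintro s₂ t₂ ⟨hW₂, hP, ht₂⟩
        refine ⟨by simpa using hW₂, ?_, ?_⟩
        · simpa [e6, State.writeN] using hP
        · simp only [List.take_succ_cons, List.length_cons, Test.cost, scalar, NExp.cost]
          omega

theorem halts_pass {p : Cmd} {g : Fin I.m → List ℕ} (hp : I.Emits p g) {n : NExp}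
    (hn : n.cost ≤ 5) {q : ℕ} {L : List (Fin I.m)} {s : State} {W : List ℕ} (hs : I.HasInput s)
    (hW : HasOutput s W) (hL : I.Points (s.nat 6) (s.nat 17 0) L)
    (hq : n.eval (s.writeN 16 0 (s.nat 17 0)) = q) :
    Halts I.table (pass n p) s fun s' t => HasOutput s' (W ++ (L.take q).flatMap g) ∧
      I.Points (s.nat 6) (s'.nat 16 0) (L.drop q) ∧ t ≤ 100 * (L.take q).length + 30 := by
  refine Halts.seq (Halts.setN (Halts.seq (Halts.setN
    ((I.halts_walk hp L q (W := W) ?_ ?_ ?_ ?_).mono ?_))))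
  · iterate 2 refine HasInput.writeN ?_ (by omega) _ _
    exact hs
  · iterate 2 refine HasOutput.writeN ?_ (by omega) _ _
    exact hW
  · simpa [scalar, NExp.eval, State.writeN] using hL
  · simp only [scalar, NExp.eval, State.writeN_nat]
    simpa [State.writeN] using hq
  · rintro s' t ⟨h1, h2, ht⟩
    refine ⟨h1, by simpa [State.writeN] using h2, ?_⟩
    simp only [scalar, NExp.cost]
    omega

theorem map_code_serve (B : List (Fin I.m)) : (I.serve B).map I.code =
    B.flatMap (fun j : Fin I.m => [3 * (j : ℕ) + 2]) ++
      B.flatMap fun j : Fin I.m => [3 * (j : ℕ) + 3] := by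
  rw [serve, List.map_append, List.map_map, List.map_map, List.map_eq_flatMap, List.map_eq_flatMap]
  rfl

theorem halts_writeFragments (L : List (Fin I.m)) {q : ℕ} (hq : 0 < q) {s : State} {W : List ℕ}
    (hs : I.HasInput s) (hW : HasOutput s W) (hL : I.Points (s.nat 6) (s.nat 17 0) L)
    (h19 : s.nat 19 0 = q) :
    Halts I.table writeFragments s fun s' t =>
      HasOutput s' (W ++ ((fragments I.cap q L).flatMap I.serve).map I.code) ∧
        t ≤ 300 * L.length + 10 := by
  induction hn : L.length using Nat.strong_induction_on generalizing L q s W with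
  | _ n ih =>
  subst hn
  rcases eq_or_ne L [] with rfl | hne
  · have h17 := hL.eq_zero_iff.2 rfl
    refine Halts.loop_done (by simp [Test.Holds, scalar, NExp.eval, h17]) ⟨?_, ?_⟩
    · simpa [fragments_eq, serve] using hW
    · simp [Test.cost, scalar, NExp.cost]
  have hlen := List.length_pos_iff.2 hne
  have h17 : s.nat 17 0 ≠ 0 := fun h => hne (hL.eq_zero_iff.1 h)
  refine Halts.loop_step (by simp only [Test.Holds, scalar, NExp.eval]; omega)
    (Halts.seq ((I.halts_pass (I.emits_stopCode 2) (q := q) (by decide) hs hW hL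
      (by simpa [scalar, NExp.eval] using h19)).frame ?_))
  rintro s₁ t₁ ⟨hW₁, -, ht₁⟩ hf - -
  have hs₁ : I.HasInput s₁ := hs.congr fun a ha => hf a (by
    simp [pass, walk, emit, Cmd.writesN]; omega)
  have e6 := hf 6 (by decide)
  have e17 := hf 17 (by decide)
  have e19 := hf 19 (by decide)
  refine Halts.seq ((I.halts_pass (I.emits_stopCode 3) (q := q) (L := L) (by decide) hs₁ hW₁
    (by rw [e6, e17]; exact hL) (by simpa [scalar, NExp.eval, e19] using h19)).frame ?_)
  rintro s₂ t₂ ⟨hW₂, hP, ht₂⟩ hf₂ - -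
  have hs₂ : I.HasInput s₂ := hs₁.congr fun a ha => hf₂ a (by
    simp [pass, walk, emit, Cmd.writesN]; omega)
  have e6₂ := (hf₂ 6 (by decide)).trans e6
  rw [List.append_assoc, ← map_code_serve] at hW₂
  refine Halts.seq (Halts.setN (Halts.setN ((ih (L.drop q).length (by
    rw [List.length_drop]; omega) (L.drop q) I.cap_pos ?_ (W := W ++ (I.serve (L.take q)).map I.code)
      ?_ ?_ ?_ rfl).mono ?_)))
  · iterate 2 refine HasInput.writeN ?_ (by omega) _ _
    exact hs₂
  · iterate 2 refine HasOutput.writeN ?_ (by omega) _ _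
    exact hW₂
  · rw [e6] at hP
    simpa [scalar, NExp.eval, State.writeN, e6₂] using hP
  · simp [MDaRP.capacity, NExp.eval, hs₂.capacity]
  · rintro s₃ t₃ ⟨hW₃, ht₃⟩
    refine ⟨?_, ?_⟩
    · convert hW₃ using 1
      rw [fragments_eq, List.flatMap_cons, List.map_append, List.append_assoc]
      congr 3
      -- If nothing remains, `fragments` still lists one empty fragment, which writes nothing.
      rcases eq_or_ne (L.drop q) [] with h | h
      · rw [h]; simp [fragments_eq, serve]
      · rw [chunks_eq_cons I.cap_pos h, fragments_eq]
    · have h1 : (L.take q).length + (L.drop q).length = L.length := by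
        rw [← List.length_append, List.take_append_drop]
      have h2 : 0 < (L.take q).length := by rw [List.length_take]; omega
      simp only [Test.cost, scalar, MDaRP.capacity, NExp.cost]
      omega

theorem halts_writeRoute {T : I.Tours} {i : Fin I.h} {ω : ℕ → ℕ} {s : State} {W : List ℕ}
    (hs : I.HasInput s) (hW : HasOutput s W) (hT : I.IsLinked (s.nat 6) T)
    (hm : (T i).length ≤ I.m) (h14 : s.nat 14 0 = i) (hω : s.tape 0 = ω i) (hpos : 1 ≤ ω i) :
    Halts I.table writeRoute s fun s' t =>
      HasOutput s' (W ++ (((I.algRoutes T fun i => ω i) i).map I.code ++ [0])) ∧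
        (s'.tape = fun k => s.tape (k + 1)) ∧ t ≤ 400 * I.m + 200 := by
  refine Halts.seq (Halts.draw (Halts.frame (Q := fun s' t =>
    HasOutput s' (W ++ (((I.algRoutes T fun i => ω i) i).map I.code ++ [0])) ∧
        t ≤ 400 * I.m + 190) ?_ ?_))
  swap
  · rintro s' t ⟨h1, h2⟩ - - htape
    refine ⟨h1, ?_, ?_⟩
    · rw [htape (by simp [pass, walk, writeFragments, emit, Cmd.DrawFree])]
      rfl
    · simp only [NExp.cost]
      omega
  have hP : I.Points (s.nat 6) (s.nat 6 i) (T i) := by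
    refine I.points_of_linked ?_
    have := hT i
    simpa [tourList, vertexId, Function.comp_def] using this
  refine Halts.seq (Halts.setN (Halts.seq ((I.halts_pass I.emits_skip (q := I.cap) (L := T i)
    (W := W) (by decide) ?_ ?_ ?_ ?_).frame ?_)))
  · refine HasInput.writeN ?_ (by omega) _ _
    exact hs.writeN (a := 19) (by omega) 0 (s.tape 0)
  · exact (hW.writeN (a := 19) (by omega) 0 (s.tape 0)).writeN (by omega) _ _
  · simpa [scalar, NExp.eval, State.writeN, h14] using hP
  · simp [scalar, NExp.eval, MDaRP.capacity, hs.capacity]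
  rintro s₁ t₁ ⟨hW₁, hP₁, ht₁⟩ hf - -
  have e6 : s₁.nat 6 = s.nat 6 := by
    rw [hf 6 (by decide)]; funext k; simp
  have e17 : s₁.nat 17 0 = s.nat 6 i := by
    rw [hf 17 (by decide)]; simp [scalar, NExp.eval, h14]
  have e19 : s₁.nat 19 0 = ω i := by
    rw [hf 19 (by decide)]; simp [NExp.eval, hω]
  have hs₁ : I.HasInput s₁ := by
    refine HasInput.congr (s := s) hs fun a ha => ?_
    rw [hf a (by simp [pass, walk, Cmd.writesN]; omega)]
    have h1 : a ≠ 17 := by omega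
    have h2 : a ≠ 19 := by omega
    funext k; simp [h1, h2]
  have hW₁' : HasOutput s₁ W := by
    rwa [List.flatMap_eq_nil_iff.2 fun _ _ => rfl, List.append_nil] at hW₁
  have htake : ((T i).take I.cap).length ≤ I.m := (List.length_take_le' _ _).trans hm
  -- The common end of both branches; `r` accounts for the time already spent.
  have hfin : ∀ {q : ℕ} {s₂ : State} {r : ℕ}, 0 < q → I.HasInput s₂ → HasOutput s₂ W →
      I.Points (s₂.nat 6) (s₂.nat 17 0) (T i) → s₂.nat 19 0 = q → r ≤ 100 * I.m + 100 →
      (fragments I.cap q (T i)).flatMap I.serve = (I.algRoutes T fun i => ω i) i →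
      Halts I.table (.seq writeFragments (emit (.const 0))) s₂ fun s' t =>
        HasOutput s' (W ++ (((I.algRoutes T fun i => ω i) i).map I.code ++ [0])) ∧
          r + t ≤ 400 * I.m + 190 := by
    intro q s₂ r hq hs₂ hW₂ hP₂ h19 hr hfrag
    refine Halts.seq ((I.halts_writeFragments (T i) hq hs₂ hW₂ hP₂ h19).mono ?_)
    rintro s₃ t₃ ⟨hW₃, ht₃⟩
    rw [hfrag] at hW₃
    refine (halts_emit hW₃ (.const 0)).mono ?_
    rintro s₄ t₄ ⟨hW₄, ht₄⟩
    refine ⟨by simpa [NExp.eval] using hW₄, ?_⟩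
    simp only [NExp.cost] at ht₄
    omega
  have hzero := hP₁.eq_zero_iff
  refine Halts.seq (Halts.ite (fun hb => Halts.skip ?_) (fun hb => Halts.setN ?_))
  · simp only [Test.Holds, scalar, NExp.eval] at hb
    have hlong : ¬ (T i).length ≤ I.cap := fun h => by
      have := hzero.2 (List.drop_eq_nil_of_le h)
      omega
    refine (hfin (r := t₁ + 30) hpos hs₁ hW₁' (by rw [e6, e17]; exact hP) e19 (by omega) ?_).mono ?_
    · rw [algRoutes, if_neg hlong]
    · rintro s' t ⟨h, ht⟩
      refine ⟨h, ?_⟩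
      simp only [Test.cost, scalar, NExp.cost]
      omega
  · simp only [Test.Holds, scalar, NExp.eval] at hb
    have hshort : (T i).length ≤ I.cap := List.drop_eq_nil_iff.1 (hzero.1 (by omega))
    refine (hfin (q := I.cap) (r := t₁ + 30) I.cap_pos (hs₁.writeN (by omega) _ _)
      (hW₁'.writeN (by omega) _ _) ?_ ?_ (by omega) ?_).mono ?_
    · simpa [State.writeN, e6, e17] using hP
    · simp [NExp.eval, MDaRP.capacity, hs₁.capacity]
    · rw [algRoutes, if_pos hshort, fragments_eq, List.take_of_length_le hshort,
        List.drop_eq_nil_of_le hshort]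
      simp
    · rintro s' t ⟨h, ht⟩
      refine ⟨h, ?_⟩
      simp only [Test.cost, scalar, MDaRP.capacity, NExp.cost]
      omega

theorem halts_writeRoutes {T : I.Tours} {ω : ℕ → ℕ} {s : State} (hs : I.HasInput s)
    (h4 : s.nat 4 0 = 0) (hT : I.IsLinked (s.nat 6) T) (hm : ∀ i, (T i).length ≤ I.m)
    (hω : s.tape = ω) (hpos : ∀ k, 1 ≤ ω k) :
    Halts I.table (forLoop 14 numVehicles writeRoute) s fun s' t =>
      I.IsOutput s' (I.algRoutes T fun i => ω i) ∧ t ≤ I.h * (400 * I.m + 300) + 100 := by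
  -- After `k` vehicles exactly `k` entries of the tape are used up.
  refine (Halts.forLoop (fun k s => s.nat 14 0 = k ∧ I.HasInput s ∧ I.IsLinked (s.nat 6) T ∧
    (s.tape = fun n => ω (n + k)) ∧ HasOutput s (((List.finRange I.h).take k).flatMap fun i =>
      ((I.algRoutes T fun i => ω i) i).map I.code ++ [0])) I.h (400 * I.m + 200) ?_ ?_ ?_).mono ?_
  · rintro k s ⟨h, hs, -⟩
    exact ⟨h, hs.numVehicles⟩
  · rintro k hk s ⟨h14, hs, hT, hω, hW⟩
    refine (I.halts_writeRoute (i := ⟨k, hk⟩) (ω := ω) hs hW hT (hm _) h14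
      (by rw [hω]; simp) (hpos _)).frame ?_
    rintro s' t ⟨hW', htape, ht⟩ hfr - -
    refine ⟨?_, ⟨by simp, ?_, ?_, ?_, ?_⟩, ht⟩
    · rw [hfr 14 (by decide), h14]
    · refine HasInput.writeN (hs.congr fun a ha => hfr a ?_) (by omega) _ _
      simp [writeRoute, writeFragments, pass, walk, emit, Cmd.writesN]; omega
    · have := hfr 6 (by decide)
      simpa [State.writeN, this] using hT
    · rw [State.writeN_tape, htape, hω]
      funext n
      exact congrArg ω (by ring)
    · refine HasOutput.writeN ?_ (by omega) _ _
      have e : (List.finRange I.h).take (k + 1) = (List.finRange I.h).take k ++ [⟨k, hk⟩] := by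
        rw [← List.take_append_getElem (by simpa using hk)]
        simp
      rw [e, List.flatMap_append]
      simpa using hW'
  · refine ⟨by simp, hs.writeN (by omega) _ _, by simpa [State.writeN] using hT, by simp [hω], ?_⟩
    refine HasOutput.writeN ⟨by simpa using h4, by simp⟩ (by omega) _ _
  · rintro s' t ⟨⟨-, -, -, -, hW⟩, ht⟩
    rw [List.take_of_length_le (by simp)] at hW
    refine ⟨hW, ?_⟩
    simp only [MDaRP.numVehicles, NExp.cost] at ht
    linarith [Nat.zero_le I.h]

theorem IsMTSP.length_le {I : Instance} {T : I.Tours} (hT : I.IsMTSP T) (i : Fin I.h) :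
    (T i).length ≤ I.m := by
  have : (T i).Nodup := List.nodup_iff_count_le_one.2 fun j => by
    rw [← hT j]
    exact Finset.single_le_sum (f := fun i => (T i).count j) (fun _ _ => Nat.zero_le _)
      (Finset.mem_univ i)
  simpa using this.length_le_card

/-- The tours come from a run with the zero tape. This part draws nothing, so it runs identically on
every tape, and `T` does not depend on `ω`. -/
theorem exec_algorithm (κ : ℕ) (hκ : I.h ≤ κ * I.m) :
    ∃ T : I.Tours, I.IsTwoApproxMTSP T ∧ ∀ ω : ℕ → ℕ, (∀ k, 1 ≤ ω k ∧ ω k ≤ I.cap) →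
      ∃ s t, Exec I.table algorithm (I.initState ω) s t ∧
        t ≤ (1000 * κ + 900) * I.m ^ 2 ∧ I.IsOutput s (I.algRoutes T fun i => ω i) := by
  obtain ⟨s, t, hexec, hs, ⟨T, hT, hlink⟩, h4, ht⟩ := I.halts_tours fun _ => 0
  refine ⟨T, hT, fun ω hω => ?_⟩
  have hexec' := hexec.retape
    (by simp [addDepots, addRequests, select, attach, relax, forLoop, Cmd.DrawFree]) ω
  obtain ⟨s', t', hexec'', hout, ht'⟩ := I.halts_writeRoutes (s := s.retape ω) (ω := ω) hs h4 hlink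
    (fun i => hT.1.length_le i) rfl fun k => (hω k).1
  refine ⟨s', t + t', .seq hexec' hexec'', ?_, hout⟩
  have hm : 1 ≤ I.m := by
    rcases Nat.eq_zero_or_pos I.m with h | h
    · rw [h, Nat.mul_zero] at hκ
      have := I.h_pos
      omega
    · exact h
  -- Both parts together take at most `h * (500 * m + 500) + 200 * m ^ 2 + 400 * m + 300` steps; `h
  -- ≤ κ * m` and `m ≥ 1` turn this into the stated multiple of `m ^ 2`.
  have h1 : I.h * (500 * I.m + 500) ≤ κ * I.m * (500 * I.m + 500 * I.m) :=
    Nat.mul_le_mul hκ (by omega)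
  have h2 : I.m ≤ I.m ^ 2 := Nat.le_self_pow two_ne_zero _
  have h3 : 1 ≤ I.m ^ 2 := hm.trans h2
  nlinarith

end Instance

end MDaRP

theorem theorem1 :
    -- approximation guarantee, whichever 2-approximate multi-depot TSP solution is used
    (∃ C : ℝ, ∀ (I : MDaRP.Instance) (T : I.Tours), I.IsTwoApproxMTSP T →
      (∀ θ : Fin I.h → ℕ, (∀ i, 1 ≤ θ i ∧ θ i ≤ I.cap) → I.IsFeasible (I.algRoutes T θ)) ∧
      I.algExpectedWeight T ≤ C * (Real.sqrt I.cap * Real.log (I.m + 1)) * I.opt) ∧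
    -- running time: one program runs the algorithm, in quadratic time if the number of vehicles is
    -- linearly bounded in the number of requests
    (∃ P : MDaRP.Cmd, ∀ κ : ℕ, ∃ C : ℕ, ∀ I : MDaRP.Instance, I.h ≤ κ * I.m →
      ∃ T : I.Tours, I.IsTwoApproxMTSP T ∧
        ∀ ω : ℕ → ℕ, (∀ k, 1 ≤ ω k ∧ ω k ≤ I.cap) →
          ∃ (s : MDaRP.State) (t : ℕ), MDaRP.Exec I.table P (I.initState ω) s t ∧
            t ≤ C * I.m ^ 2 ∧ I.IsOutput s (I.algRoutes T fun i => ω i)) :=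
  ⟨⟨200, fun I _ hT => ⟨fun _ hθ => I.isFeasible_algRoutes hT.1 fun i => (hθ i).2,
    I.algExpectedWeight_le_opt hT⟩⟩,
    ⟨MDaRP.algorithm, fun κ => ⟨1000 * κ + 900, fun I hκ => I.exec_algorithm κ hκ⟩⟩⟩
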